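/- **Proposition (Gradient of the Meta-Objective).** Let $\mathcal S$ be a measurable state space and $\mathcal A$ a finite nonempty action space. For $i\in[n]$ let $(\mathcal S,\mathcal A,P_i,r_i,\gamma_i,\zeta_i)$ be an MDP with Markov kernel $P_i$, possibly stochastic reward $r_i$ with $|r_i|\le Q_{\max}$ almost surely, discount factor $\gamma_i\in(0,1)$ and initial distribution $\zeta_i$. For a policy $\pi$ (a measurable map from states to distributions over $\mathcal A$), with $s_{t+1}\sim P_i(\cdot\,|\,s_t,a_t)$ and $a_t\sim\pi(\cdot\,|\,s_t)$, put $$V_i^\pi(s)=(1-\gamma_i)\,\mathbb E\Bigl[\sum_{t\ge0}\gamma_i^t r_i(s_t,a_t)\Bigm|s_0=s\Bigr],\qquad Q_i^\pi(s,a)=(1-\gamma_i)\,\mathbb E\Bigl[\sum_{t\ge0}\gamma_i^t r_i(s_t,a_t)\Bigm|s_0=s,a_0=a\Bigr],$$ $A_i^\pi(s,a)=Q_i^\pi(s,a)-V_i^\pi(s)$ and $J_i(\pi)=\mathbb E_{s\sim\zeta_i}[V_i^\pi(s)]$. Let $\nu_{i,\pi}=(1-\gamma_i)\sum_{t\ge0}\gamma_i^t\,\mathbb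 P(s_t\in\cdot)$ with $s_0\sim\zeta_i$ be the state visitation measure, $\sigma_{i,\pi}(ds,a)=\pi(a\,|\,s)\,\nu_{i,\pi}(ds)$ the state-action visitation measure, and $\sigma_{i,\pi}^{(s,a)}=(1-\gamma_i)\sum_{t\ge0}\gamma_i^t\,\mathbb P((s_t,a_t)\in\cdot)$ with $s_0\sim P_i(\cdot\,|\,s,a)$. Let $\phi:\mathcal S\times\mathcal A\to\mathbb R^d$ be a bounded measurable feature map, $\tau,\eta>0$, and for $\theta\in\mathbb R^d$ let $\pi_\theta(a\,|\,s)\propto\exp(\phi(s,a)^\top\theta/\tau)$ be the energy-based policy. Consider one step of PPO from $\pi_\theta$ on task $i$, that is, the maximization over all policies $\pi$ of $$\mathbb E_{s\sim\nu_{i,\pi_\theta}}\Bigl[\langle Q_i^{\pi_\theta}(s,\cdot),\pi(\cdot\,|\,s)\rangle-\tfrac1\eta D_{\mathrm{KL}}\bigl(\pi(\cdot\,|\,s)\,\|\,\pi_\theta(\cdot\,|\,s)\bigr)\Bigr].$$ The policy proportional to $\exp\bigl(\phi(s,\cdot)^\top\theta/\tau+\eta\,Q_i^{\pi_\theta}(s,\cdot)\bigr)$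 for every $s\in\mathcal S$ is a maximizer. Moreover, for any choice of maximizers $\pi_{i,\theta}$ ($i\in[n]$, $\theta\in\mathbb R^d$), the meta-objective $L(\theta)=\frac1n\sum_{i=1}^nJ_i(\pi_{i,\theta})$ is differentiable at every $\theta\in\mathbb R^d$, with $$\nabla_\theta L(\theta)=\frac1n\sum_{i=1}^n\frac1{1-\gamma_i}\;\mathbb E_{(s,a)\sim\sigma_{i,\pi_{i,\theta}}}\bigl[h_{i,\theta}(s,a)\,A_i^{\pi_{i,\theta}}(s,a)\bigr],$$ $$h_{i,\theta}(s,a)=\frac1\tau\,\phi(s,a)+\frac{\eta\,\gamma_i}{\tau\,(1-\gamma_i)}\;\mathbb E_{(s',a')\sim\sigma_{i,\pi_\theta}^{(s,a)}}\bigl[\phi(s',a')\,A_i^{\pi_\theta}(s',a')\bigr].$$ -/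

import Mathlib

open MeasureTheory ProbabilityTheory
open scoped ENNReal

namespace MetaRL

/-- A discounted Markov decision process with (possibly stochastic) rewards: the transition
kernel `P`, the conditional law `R (s, a)` of the reward `r(s, a)`, the discount factor `γ`
and the initial state distribution `ζ`. -/
structure MDP (S A : Type*) [MeasurableSpace S] [MeasurableSpace A] where
  P : Kernel (S × A) S
  R : Kernel (S × A) ℝ
  γ : ℝ
  ζ : Measure S
  isMarkovKernel_P : IsMarkovKernel P
  isMarkovKernel_R : IsMarkovKernel R
  γ_pos : 0 < γ
  γ_lt_one : γ < 1
  isProbabilityMeasure_ζ : IsProbabilityMeasure ζ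

/-- A policy: a measurable map from states to probability distributions over actions. -/
structure Policy (S A : Type*) [MeasurableSpace S] [MeasurableSpace A] where
  kernel : Kernel S A
  isMarkovKernel : IsMarkovKernel kernel

attribute [instance] MDP.isMarkovKernel_P MDP.isMarkovKernel_R MDP.isProbabilityMeasure_ζ
  Policy.isMarkovKernel

section Trajectories

variable {S A : Type*} [MeasurableSpace S] [MeasurableSpace A]

/-- Given `(s, a)`, draw the reward: the law of `((s, a), r(s, a))`. -/
noncomputable def rewardStep (M : MDP S A) : Kernel (S × A) ((S × A) × ℝ) :=
  Kernel.id ×ₖ M.R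

instance (M : MDP S A) : IsMarkovKernel (rewardStep M) := by
  unfold rewardStep; infer_instance

/-- Given `s`, draw the action from `π(· | s)`, then the reward: the law of `((s, a), r(s, a))`. -/
noncomputable def actStep (M : MDP S A) (π : Policy S A) : Kernel S ((S × A) × ℝ) :=
  rewardStep M ∘ₖ (Kernel.id ×ₖ π.kernel)

instance (M : MDP S A) (π : Policy S A) : IsMarkovKernel (actStep M π) := by
  unfold actStep; infer_instance

/-- One step of the interaction: from `((sₜ, aₜ), rₜ)` to `((sₜ₊₁, aₜ₊₁), rₜ₊₁)`, where
`sₜ₊₁ ∼ P(· | sₜ, aₜ)` and `aₜ₊₁ ∼ π(· | sₜ₊₁)`. -/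
noncomputable def step (M : MDP S A) (π : Policy S A) :
    Kernel ((S × A) × ℝ) ((S × A) × ℝ) :=
  (actStep M π ∘ₖ M.P).comap Prod.fst measurable_fst

instance (M : MDP S A) (π : Policy S A) : IsMarkovKernel (step M π) := by
  unfold step; infer_instance

/-- The law of the trajectory `t ↦ ((sₜ, aₜ), rₜ)` under the policy `π`, when `((s₀, a₀), r₀)`
has law `ρ`. -/
noncomputable def trajLaw (M : MDP S A) (π : Policy S A) (ρ : Measure ((S × A) × ℝ)) :
    Measure (ℕ → (S × A) × ℝ) :=
  Kernel.trajMeasure (X := fun _ : ℕ => (S × A) × ℝ) ρ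
    (fun n => (step M π).comap
      (fun h : (Finset.Iic n → (S × A) × ℝ) => h ⟨n, Finset.mem_Iic.2 le_rfl⟩)
      (measurable_pi_apply _))

/-- The law of the trajectory when `s₀ ∼ μ` and `aₜ ∼ π(· | sₜ)` for all `t ≥ 0`. -/
noncomputable def trajLawState (M : MDP S A) (π : Policy S A) (μ : Measure S) :
    Measure (ℕ → (S × A) × ℝ) :=
  trajLaw M π (actStep M π ∘ₘ μ)

/-- The law of the trajectory when `s₀ = s`, `a₀ = a` and `aₜ ∼ π(· | sₜ)` for all `t ≥ 1`. -/
noncomputable def trajLawStateAction (M : MDP S A) (π : Policy S A) (x : S × A) :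
    Measure (ℕ → (S × A) × ℝ) :=
  trajLaw M π (rewardStep M x)

/-- State-value function `V^π(s) = (1 - γ) E[∑ₜ γᵗ rₜ | s₀ = s]`. -/
noncomputable def V (M : MDP S A) (π : Policy S A) (s : S) : ℝ :=
  (1 - M.γ) * ∫ ω, ∑' t : ℕ, M.γ ^ t * (ω t).2 ∂(trajLawState M π (Measure.dirac s))

/-- Action-value function `Q^π(s, a) = (1 - γ) E[∑ₜ γᵗ rₜ | s₀ = s, a₀ = a]`. -/
noncomputable def Q (M : MDP S A) (π : Policy S A) (x : S × A) : ℝ :=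
  (1 - M.γ) * ∫ ω, ∑' t : ℕ, M.γ ^ t * (ω t).2 ∂(trajLawStateAction M π x)

/-- Advantage function `A^π(s, a) = Q^π(s, a) - V^π(s)`. -/
noncomputable def advantage (M : MDP S A) (π : Policy S A) (x : S × A) : ℝ :=
  Q M π x - V M π x.1

/-- Expected total reward `J(π) = E_{s ∼ ζ}[V^π(s)]`. -/
noncomputable def J (M : MDP S A) (π : Policy S A) : ℝ :=
  ∫ s, V M π s ∂M.ζ

/-- State visitation measure `ν_π = (1 - γ) ∑ₜ γᵗ P(sₜ ∈ ·)`, where `s₀ ∼ ζ`. -/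
noncomputable def stateVisitation (M : MDP S A) (π : Policy S A) : Measure S :=
  Measure.sum fun t : ℕ => ENNReal.ofReal ((1 - M.γ) * M.γ ^ t) •
    (trajLawState M π M.ζ).map (fun ω => (ω t).1.1)

/-- State-action visitation measure `σ_π(ds, a) = π(a | s) ν_π(ds)`. -/
noncomputable def visitation (M : MDP S A) (π : Policy S A) : Measure (S × A) :=
  stateVisitation M π ⊗ₘ π.kernel

/-- State-action visitation measure initialized at `(s, a)`:
`σ_π^{(s, a)} = (1 - γ) ∑ₜ γᵗ P((sₜ, aₜ) ∈ ·)`, where `s₀ ∼ P(· | s, a)`. -/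
noncomputable def visitationFrom (M : MDP S A) (π : Policy S A) (x : S × A) :
    Measure (S × A) :=
  Measure.sum fun t : ℕ => ENNReal.ofReal ((1 - M.γ) * M.γ ^ t) •
    (trajLawState M π (M.P x)).map (fun ω => (ω t).1)

/-- The objective of one step of proximal policy optimization started at the policy `π₀`:
`E_{s ∼ ν_{π₀}}[⟨Q^{π₀}(s, ·), π(· | s)⟩ - 1/η · KL(π(· | s) ‖ π₀(· | s))]`. -/
noncomputable def ppoObjective [Fintype A] (M : MDP S A) (η : ℝ) (π₀ π : Policy S A) : ℝ :=
  ∫ s, ((∑ a, Q M π₀ (s, a) * (π.kernel s).real {a})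
    - 1 / η * (InformationTheory.klDiv (π.kernel s) (π₀.kernel s)).toReal)
    ∂(stateVisitation M π₀)

/-- `π` is a maximizer, over all policies, of the objective of one step of proximal policy
optimization started at `π₀`. -/
def IsPPOStep [Fintype A] (M : MDP S A) (η : ℝ) (π₀ π : Policy S A) : Prop :=
  ∀ π' : Policy S A, ppoObjective M η π₀ π' ≤ ppoObjective M η π₀ π

end Trajectories

section Energy

variable {S A : Type*} [MeasurableSpace S] [Fintype A] [MeasurableSpace A]

/-- The energy-based policy `π(a | s) = exp(f(s, a)) / ∑_{a'} exp(f(s, a'))`. -/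
noncomputable def energyPolicy [Nonempty A] (f : S × A → ℝ) (hf : Measurable f) :
    Policy S A where
  kernel :=
    { toFun := fun s => ∑ a, ENNReal.ofReal
        (Real.exp (f (s, a)) / ∑ a', Real.exp (f (s, a'))) • Measure.dirac a
      measurable' := by
        refine Measure.measurable_of_measurable_coe _ fun B _ => ?_
        simp only [Measure.coe_finsetSum, Finset.sum_apply, Measure.smul_apply, smul_eq_mul]
        refine Finset.measurable_sum _ fun a _ => Measurable.mul_const ?_ _
        fun_prop }
  isMarkovKernel := by
    refine ⟨fun s => ⟨?_⟩⟩
    have hpos : 0 < ∑ a', Real.exp (f (s, a')) :=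
      Finset.sum_pos (fun a _ => Real.exp_pos _) Finset.univ_nonempty
    change (∑ a, ENNReal.ofReal
        (Real.exp (f (s, a)) / ∑ a', Real.exp (f (s, a'))) • Measure.dirac a) Set.univ = 1
    simp only [Measure.coe_finsetSum, Finset.sum_apply, Measure.smul_apply, smul_eq_mul,
      measure_univ, mul_one]
    rw [← ENNReal.ofReal_sum_of_nonneg (fun a _ => by positivity), ← Finset.sum_div,
      div_self hpos.ne', ENNReal.ofReal_one]

/-- The main effect: `π_θ(a | s) ∝ exp(1/τ · φ(s, a)ᵀ θ)`. -/
noncomputable def mainEffect [Nonempty A] {d : ℕ} (φ : S × A → EuclideanSpace ℝ (Fin d))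
    (hφ : Measurable φ) (τ : ℝ) (θ : EuclideanSpace ℝ (Fin d)) : Policy S A :=
  energyPolicy (fun x => 1 / τ * inner ℝ (φ x) θ)
    ((hφ.inner measurable_const).const_mul _)

end Energy

section Meta

variable {S A : Type*} [MeasurableSpace S] [MeasurableSpace A]

/-- The meta-objective `L(θ) = 1/n · ∑ᵢ Jᵢ(π_{i,θ})` of the adapted policies `π_{i,θ}`. -/
noncomputable def metaObjective {n d : ℕ} (M : Fin n → MDP S A)
    (πad : Fin n → EuclideanSpace ℝ (Fin d) → Policy S A) (θ : EuclideanSpace ℝ (Fin d)) : ℝ :=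
  1 / (n : ℝ) * ∑ i, J (M i) (πad i θ)

/-- The auxiliary function
`h(s, a) = 1/τ · φ(s, a) + η γ / (τ (1 - γ)) · E_{x' ∼ σ_{π₀}^{(s, a)}}[A^{π₀}(x') φ(x')]`. -/
noncomputable def auxiliary {d : ℕ} (M : MDP S A) (φ : S × A → EuclideanSpace ℝ (Fin d))
    (τ η : ℝ) (π₀ : Policy S A) (x : S × A) : EuclideanSpace ℝ (Fin d) :=
  (1 / τ) • φ x + (η * M.γ / (τ * (1 - M.γ))) •
    ∫ x', advantage M π₀ x' • φ x' ∂(visitationFrom M π₀ x)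

end Meta

end MetaRL

open MetaRL

/-!
The trajectory law is the law of a Markov chain, so both value functions and all visitation
measures are expressed through the normalized resolvent `G = (1 - γ) ∑ₜ γᵗ Kᵗ` of the kernel `K` of
the chain of state-action pairs. The two forms of the resolvent equation give the Bellman equation
`Q_bellman` and the flow equation `stateVisitation_flow`, and these two give the performance
difference lemma `J(π') - J(π) = (1 - γ)⁻¹ ∫ A^π dσ_{π'}` (`performance_difference`).

*Maximizers.* For fixed `s` the integrand of the proximal objective is, by Gibbs' variational
identity, a term independent of `π` minus `η⁻¹` times the divergence of `π(· | s)` from the policy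
proportional to `exp(φᵀθ/τ + η Q)`. So this policy is a maximizer, and every other maximizer agrees
with it almost everywhere for the state visitation measure of `π_θ` (`ppoObjective_eq`,
`IsPPOStep.ae_eq`). As `π_θ` charges every action, it visits every state that any policy visits, so
agreement there leaves the visitation measures, the expected total reward and, almost everywhere,
the advantage function unchanged (`visitation_congr`, `J_congr`, `advantage_congr`). It is
therefore enough to differentiate along the energy-based maximizers.

*Gradient.* Let `f`, `g` be energies with `|g - f| ≤ ε ≤ 1`. In the performance difference the
visitation measure of the new policy may be replaced by that of the old one, since the advantage
averaged over the new policy is `O(ε)` and the visitation measure is Lipschitz in the policy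
(`abs_integral_stateVisitation_sub_le`). With the expansion of the softmax map this gives
`J(π_g) = J(π_f) + (1 - γ)⁻¹ ∫ (g - f) A^{π_f} dσ_{π_f} + O(ε²)`, with a constant that depends only
on the bound on the rewards and on `γ` (`abs_policy_gradient_remainder_le`). The constant does not
involve the initial distribution, so the expansion can be applied with initial distribution
`P(· | s, a)` for all `(s, a)` at once: it expands `Q^{π_θ}(s, a)`, and so the energy
`φᵀθ/τ + η Q^{π_θ}`, uniformly, with derivative `h` (`abs_Q_mainEffect_remainder_le`,
`inner_auxiliary`). Applying it a second time, to this energy, gives the gradient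
(`hasGradientAt_J_adapted`).
-/

namespace MetaRL

/-! ### The chain of state-action pairs -/

section Chain

variable {S A : Type*} [MeasurableSpace S] [MeasurableSpace A]

/-- The transition kernel of the chain `(sₜ, aₜ)` under the policy `π`. -/
noncomputable def pairKernel (M : MDP S A) (π : Policy S A) : Kernel (S × A) (S × A) :=
  (Kernel.id ×ₖ π.kernel) ∘ₖ M.P

instance (M : MDP S A) (π : Policy S A) : IsMarkovKernel (pairKernel M π) := by
  unfold pairKernel; infer_instance

instance isMarkovKernel_pow {X : Type*} [MeasurableSpace X] (K : Kernel X X) [IsMarkovKernel K]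
    (t : ℕ) : IsMarkovKernel (K ^ t) := by
  induction t with
  | zero => exact (inferInstance : IsMarkovKernel (Kernel.id : Kernel X X))
  | succ t ih => exact (inferInstance : IsMarkovKernel ((K ^ t) ∘ₖ K))

lemma comap_comp_measure {X Y Z : Type*} [MeasurableSpace X] [MeasurableSpace Y]
    [MeasurableSpace Z] (K : Kernel Y Z) {g : X → Y} (hg : Measurable g) (μ : Measure X) :
    (K.comap g hg) ∘ₘ μ = K ∘ₘ (μ.map g) := by
  rw [← Measure.deterministic_comp_eq_map hg, Measure.comp_assoc, Kernel.comp_deterministic_eq_comap]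

lemma map_eval_zero_trajLaw (M : MDP S A) (π : Policy S A) (ρ : Measure ((S × A) × ℝ))
    [IsProbabilityMeasure ρ] : (trajLaw M π ρ).map (fun ω => ω 0) = ρ := by
  have h : (fun ω : ℕ → (S × A) × ℝ => ω 0) =
      (MeasurableEquiv.piUnique (fun _ : Finset.Iic 0 => (S × A) × ℝ)) ∘
        (Preorder.frestrictLe (π := fun _ : ℕ => (S × A) × ℝ) 0) := by
    ext ω <;> rfl
  rw [h, ← Measure.map_map (by fun_prop) (by fun_prop), trajLaw, Kernel.trajMeasure,
    Measure.map_comp _ _ (by fun_prop), Kernel.traj_map_frestrictLe, Kernel.partialTraj_self]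
  erw [Measure.id_comp]
  rw [Measure.map_map (by fun_prop) (by fun_prop)]
  exact Measure.map_id

/-- The coordinate process under `trajLaw` is a Markov chain with kernel `step`. -/
lemma map_eval_succ_trajLaw (M : MDP S A) (π : Policy S A) (ρ : Measure ((S × A) × ℝ))
    [IsProbabilityMeasure ρ] (t : ℕ) :
    (trajLaw M π ρ).map (fun ω => ω (t + 1)) =
      step M π ∘ₘ ((trajLaw M π ρ).map (fun ω => ω t)) := by
  have h := Kernel.map_frestrictLe_trajMeasure_compProd_eq_map_trajMeasure
    (X := fun _ : ℕ => (S × A) × ℝ) (μ₀ := ρ) (κ := (fun n => (step M π).comap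
      (fun h : (Finset.Iic n → (S × A) × ℝ) => h ⟨n, Finset.mem_Iic.2 le_rfl⟩)
      (measurable_pi_apply _))) (a := t)
  have h2 := congrArg (fun m => Measure.map Prod.snd m) h
  rw [Measure.map_map (by fun_prop) (by fun_prop)] at h2
  change Measure.snd _ = _ at h2
  rw [Measure.snd_compProd, comap_comp_measure, Measure.map_map (by fun_prop) (by fun_prop)] at h2
  exact h2.symm

instance (M : MDP S A) (π : Policy S A) (ρ : Measure ((S × A) × ℝ)) [IsProbabilityMeasure ρ] :
    IsProbabilityMeasure (trajLaw M π ρ) := by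
  unfold trajLaw; infer_instance

lemma map_fst_rewardStep_comp (M : MDP S A) (α : Measure (S × A)) [SFinite α] :
    (rewardStep M ∘ₘ α).map Prod.fst = α := by
  rw [rewardStep, ← Measure.compProd_eq_comp_prod]
  exact Measure.fst_compProd α M.R

lemma actStep_comp (M : MDP S A) (π : Policy S A) (μ : Measure S) [SFinite μ] :
    actStep M π ∘ₘ μ = rewardStep M ∘ₘ (μ ⊗ₘ π.kernel) := by
  rw [actStep, Measure.compProd_eq_comp_prod, Measure.comp_assoc]

/-- If the initial reward is drawn from the initial state-action pair, then the triple at time `t`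
is obtained by running the chain of state-action pairs for `t` steps and drawing the reward. -/
lemma map_eval_trajLaw (M : MDP S A) (π : Policy S A) (α : Measure (S × A))
    [IsProbabilityMeasure α] (t : ℕ) :
    (trajLaw M π (rewardStep M ∘ₘ α)).map (fun ω => ω t) =
      rewardStep M ∘ₘ ((pairKernel M π ^ t) ∘ₘ α) := by
  induction t with
  | zero =>
    rw [map_eval_zero_trajLaw]
    rw [pow_zero]
    exact congrArg (fun m => rewardStep M ∘ₘ m) (Measure.id_comp (μ := α)).symm
  | succ t ih =>
    rw [map_eval_succ_trajLaw, ih, step, comap_comp_measure, map_fst_rewardStep_comp, pow_succ']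
    change _ = rewardStep M ∘ₘ ((pairKernel M π ∘ₖ _) ∘ₘ α)
    rw [← Measure.comp_assoc, ← Measure.comp_assoc, actStep, pairKernel, ← Measure.comp_assoc,
      ← Measure.comp_assoc]

end Chain

/-! ### Integrals of bounded functions against Markov kernels -/

section Bounded

variable {X Y : Type*} [MeasurableSpace X] [MeasurableSpace Y]

lemma integrable_of_abs_le {f : X → ℝ} {C : ℝ} (hf : Measurable f) (hC : ∀ x, |f x| ≤ C)
    (μ : Measure X) [IsFiniteMeasure μ] : Integrable f μ :=
  Integrable.of_bound hf.aestronglyMeasurable C (ae_of_all _ hC)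

lemma abs_integral_le_of_abs_le {f : X → ℝ} {C : ℝ} (μ : Measure X) [IsProbabilityMeasure μ]
    (hC : ∀ᵐ x ∂μ, |f x| ≤ C) : |∫ x, f x ∂μ| ≤ C := by
  simpa using norm_integral_le_of_norm_le_const (μ := μ) (f := f) hC

lemma integral_comp_measure {f : Y → ℝ} {C : ℝ} (hf : Measurable f) (hC : ∀ x, |f x| ≤ C)
    (κ : Kernel X Y) [IsMarkovKernel κ] (μ : Measure X) [IsFiniteMeasure μ] :
    ∫ y, f y ∂(κ ∘ₘ μ) = ∫ x, ∫ y, f y ∂(κ x) ∂μ := by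
  have h := integrable_of_abs_le hf hC (κ ∘ₘ μ)
  rw [Measure.comp_eq_comp_const_apply] at h ⊢
  rw [Kernel.integral_comp h]
  simp

lemma integral_compProd_of_abs_le {f : X × Y → ℝ} {C : ℝ} (hf : Measurable f)
    (hC : ∀ x, |f x| ≤ C) (μ : Measure X) [IsFiniteMeasure μ] (κ : Kernel X Y)
    [IsMarkovKernel κ] :
    ∫ z, f z ∂(μ ⊗ₘ κ) = ∫ x, ∫ y, f (x, y) ∂(κ x) ∂μ :=
  Measure.integral_compProd (integrable_of_abs_le hf hC _)

lemma measurable_integral_kernel {f : Y → ℝ} (hf : Measurable f) (κ : Kernel X Y) :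
    Measurable fun x => ∫ y, f y ∂(κ x) :=
  (StronglyMeasurable.integral_kernel hf.stronglyMeasurable).measurable

lemma measurable_integral_kernel_prod {f : X × Y → ℝ} (hf : Measurable f) (κ : Kernel X Y)
    [IsMarkovKernel κ] : Measurable fun x => ∫ y, f (x, y) ∂(κ x) :=
  (StronglyMeasurable.integral_kernel_prod_right' (κ := κ) hf.stronglyMeasurable).measurable

end Bounded

/-! ### The normalized resolvent of a Markov kernel -/

section Resolvent

variable {X : Type*} [MeasurableSpace X]

/-- The normalized resolvent `(1 - γ) ∑ₜ γᵗ Kᵗ` of a kernel `K`. -/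
noncomputable def resolvent (K : Kernel X X) (γ : ℝ) : Kernel X X where
  toFun x := Measure.sum fun t : ℕ => ENNReal.ofReal ((1 - γ) * γ ^ t) • (K ^ t) x
  measurable' := by
    refine Measure.measurable_of_measurable_coe _ fun B hB => ?_
    simp only [Measure.sum_apply _ hB, Measure.smul_apply, smul_eq_mul]
    exact Measurable.tsum fun t => ((K ^ t).measurable_coe hB).const_mul _

lemma resolvent_apply (K : Kernel X X) (γ : ℝ) (x : X) :
    resolvent K γ x = Measure.sum fun t : ℕ => ENNReal.ofReal ((1 - γ) * γ ^ t) • (K ^ t) x := rfl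

lemma tsum_ofReal_discount {γ : ℝ} (h0 : 0 < γ) (h1 : γ < 1) :
    ∑' t : ℕ, ENNReal.ofReal ((1 - γ) * γ ^ t) = 1 := by
  have h1' : 0 < 1 - γ := by linarith
  rw [← ENNReal.ofReal_tsum_of_nonneg (fun t => by positivity)
    ((summable_geometric_of_lt_one h0.le h1).mul_left _), tsum_mul_left,
    tsum_geometric_of_lt_one h0.le h1, mul_inv_cancel₀ h1'.ne', ENNReal.ofReal_one]

lemma isMarkovKernel_resolvent (K : Kernel X X) [IsMarkovKernel K] {γ : ℝ} (h0 : 0 < γ)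
    (h1 : γ < 1) : IsMarkovKernel (resolvent K γ) := by
  refine ⟨fun x => ⟨?_⟩⟩
  simp only [resolvent_apply, Measure.sum_apply _ MeasurableSet.univ, Measure.smul_apply,
    measure_univ, smul_eq_mul, mul_one]
  exact tsum_ofReal_discount h0 h1

lemma resolvent_comp (K : Kernel X X) (γ : ℝ) (α : Measure X) :
    resolvent K γ ∘ₘ α =
      Measure.sum fun t : ℕ => ENNReal.ofReal ((1 - γ) * γ ^ t) • ((K ^ t) ∘ₘ α) := by
  ext B hB
  rw [Measure.bind_apply hB (Kernel.aemeasurable _), Measure.sum_apply _ hB]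
  simp only [resolvent_apply, Measure.sum_apply _ hB, Measure.smul_apply, smul_eq_mul]
  rw [lintegral_tsum fun t => (((K ^ t).measurable_coe hB).const_mul _).aemeasurable]
  congr with t
  rw [lintegral_const_mul _ ((K ^ t).measurable_coe hB),
    Measure.bind_apply hB (Kernel.aemeasurable _)]

lemma ofReal_discount_succ {γ : ℝ} (h0 : 0 < γ) (t : ℕ) :
    ENNReal.ofReal ((1 - γ) * γ ^ (t + 1)) =
      ENNReal.ofReal γ * ENNReal.ofReal ((1 - γ) * γ ^ t) := by
  rw [← ENNReal.ofReal_mul h0.le]; congr 1; ring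

/-- The resolvent equation `G = (1 - γ) + γ K G`. -/
lemma resolvent_comp_eq (K : Kernel X X) {γ : ℝ} (h0 : 0 < γ) (α : Measure X) :
    resolvent K γ ∘ₘ α =
      ENNReal.ofReal (1 - γ) • α + ENNReal.ofReal γ • (K ∘ₘ (resolvent K γ ∘ₘ α)) := by
  rw [resolvent_comp, Measure.bind_sum _ _ (Kernel.aemeasurable _)]
  ext B hB
  simp only [Measure.sum_apply _ hB, Measure.add_apply, Measure.smul_apply, smul_eq_mul]
  rw [tsum_eq_zero_add' ENNReal.summable, ← ENNReal.tsum_mul_left]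
  congr 1
  · rw [pow_zero, pow_zero, mul_one]
    exact congrArg (fun m : Measure X => _ * m B) Measure.id_comp
  · congr with t
    rw [ofReal_discount_succ h0, Measure.comp_smul, Measure.comp_assoc, Measure.smul_apply,
      smul_eq_mul, mul_assoc, pow_succ']
    rfl

/-- The resolvent equation `G = (1 - γ) + γ G K`. -/
lemma resolvent_comp_eq' (K : Kernel X X) {γ : ℝ} (h0 : 0 < γ) (α : Measure X) :
    resolvent K γ ∘ₘ α =
      ENNReal.ofReal (1 - γ) • α + ENNReal.ofReal γ • (resolvent K γ ∘ₘ (K ∘ₘ α)) := by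
  rw [resolvent_comp, resolvent_comp]
  ext B hB
  simp only [Measure.sum_apply _ hB, Measure.add_apply, Measure.smul_apply, smul_eq_mul]
  rw [tsum_eq_zero_add' ENNReal.summable, ← ENNReal.tsum_mul_left]
  congr 1
  · rw [pow_zero, pow_zero, mul_one]
    exact congrArg (fun m : Measure X => _ * m B) Measure.id_comp
  · congr with t
    rw [ofReal_discount_succ h0, Measure.comp_assoc, mul_assoc, pow_succ]
    rfl

lemma integral_discount_add {f : X → ℝ} {C γ : ℝ} (h0 : 0 < γ) (h1 : γ < 1) (hf : Measurable f)
    (hC : ∀ x, |f x| ≤ C) (μ ν : Measure X) [IsFiniteMeasure μ] [IsFiniteMeasure ν] :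
    ∫ x, f x ∂(ENNReal.ofReal (1 - γ) • μ + ENNReal.ofReal γ • ν) =
      (1 - γ) * ∫ x, f x ∂μ + γ * ∫ x, f x ∂ν := by
  rw [integral_add_measure
    ((integrable_of_abs_le hf hC μ).smul_measure ENNReal.ofReal_ne_top)
    ((integrable_of_abs_le hf hC ν).smul_measure ENNReal.ofReal_ne_top),
    integral_smul_measure, integral_smul_measure, ENNReal.toReal_ofReal (by linarith),
    ENNReal.toReal_ofReal h0.le, smul_eq_mul, smul_eq_mul]

/-- Expected discounted sums along the chain with kernel `K` are integrals against its
resolvent. -/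
lemma integral_resolvent_comp {f : X → ℝ} {C : ℝ} (K : Kernel X X) [IsMarkovKernel K] {γ : ℝ}
    (h0 : 0 < γ) (h1 : γ < 1) (hf : Measurable f) (hC : ∀ x, |f x| ≤ C) (α : Measure X)
    [IsProbabilityMeasure α] :
    ∫ x, f x ∂(resolvent K γ ∘ₘ α) = (1 - γ) * ∑' t : ℕ, γ ^ t * ∫ x, f x ∂((K ^ t) ∘ₘ α) := by
  have := isMarkovKernel_resolvent K h0 h1
  have hint := integrable_of_abs_le hf hC (resolvent K γ ∘ₘ α)
  rw [resolvent_comp] at hint ⊢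
  rw [integral_sum_measure hint, ← tsum_mul_left]
  congr with t
  have h1' : 0 < 1 - γ := by linarith
  rw [integral_smul_measure, ENNReal.toReal_ofReal (by positivity), smul_eq_mul, mul_assoc]

end Resolvent

/-! ### Value functions and the Bellman equation -/

section Values

variable {S A : Type*} [MeasurableSpace S] [MeasurableSpace A] (M : MDP S A) (π : Policy S A)

/-- The mean reward `E[r(s, a)]`. -/
noncomputable def meanReward (x : S × A) : ℝ := ∫ y, y ∂(M.R x)

lemma measurable_meanReward : Measurable (meanReward M) :=
  measurable_integral_kernel measurable_id M.R

variable {M} in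
lemma abs_meanReward_le {q : ℝ} (hR : ∀ x, ∀ᵐ y ∂(M.R x), |y| ≤ q) (x : S × A) :
    |meanReward M x| ≤ q :=
  abs_integral_le_of_abs_le _ (hR x)

/-- The normalized resolvent of the chain of state-action pairs. -/
noncomputable abbrev occupation : Kernel (S × A) (S × A) := resolvent (pairKernel M π) M.γ

instance : IsMarkovKernel (occupation M π) :=
  isMarkovKernel_resolvent _ M.γ_pos M.γ_lt_one

lemma rewardStep_comp (β : Measure (S × A)) [SFinite β] : rewardStep M ∘ₘ β = β ⊗ₘ M.R := by
  rw [rewardStep, Measure.compProd_eq_comp_prod]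

variable {M} in
/-- The rewards only enter the expected return through their means: both value functions are
integrals of the mean reward against the resolvent of the chain of state-action pairs. -/
lemma integral_discounted_reward {q : ℝ} (hR : ∀ x, ∀ᵐ y ∂(M.R x), |y| ≤ q)
    (α : Measure (S × A)) [IsProbabilityMeasure α] :
    (1 - M.γ) * ∫ ω, ∑' t : ℕ, M.γ ^ t * (ω t).2 ∂(trajLaw M π (rewardStep M ∘ₘ α)) =
      ∫ x, meanReward M x ∂(occupation M π ∘ₘ α) := by
  have h0 := M.γ_pos
  have h1 := M.γ_lt_one
  rw [integral_resolvent_comp _ h0 h1 (measurable_meanReward M) (abs_meanReward_le hR)]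
  have key : ∀ t, (∀ᵐ ω ∂(trajLaw M π (rewardStep M ∘ₘ α)), |(ω t).2| ≤ q) ∧
      ∫ ω, (ω t).2 ∂(trajLaw M π (rewardStep M ∘ₘ α)) =
        ∫ x, meanReward M x ∂(⇑(pairKernel M π ^ t) ∘ₘ α) := by
    intro t
    have hmap := map_eval_trajLaw M π α t
    rw [rewardStep_comp M (⇑(pairKernel M π ^ t) ∘ₘ α)] at hmap
    have hb : ∀ᵐ z ∂((⇑(pairKernel M π ^ t) ∘ₘ α) ⊗ₘ M.R), |z.2| ≤ q :=
      Measure.ae_compProd_of_ae_ae (measurableSet_le (by fun_prop) (by fun_prop))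
        (ae_of_all _ hR)
    constructor
    · rw [← hmap] at hb
      exact ae_of_ae_map (measurable_pi_apply t).aemeasurable hb
    · have hi : Integrable (fun z : (S × A) × ℝ => z.2)
          ((⇑(pairKernel M π ^ t) ∘ₘ α) ⊗ₘ M.R) :=
        Integrable.of_bound measurable_snd.aestronglyMeasurable q hb
      rw [← integral_map (φ := fun ω : ℕ → (S × A) × ℝ => ω t) (f := fun z => z.2)
        (measurable_pi_apply t).aemeasurable measurable_snd.aestronglyMeasurable, hmap,
        Measure.integral_compProd hi]
      rfl
  congr 1
  rw [← integral_tsum_of_summable_integral_norm]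
  · congr with t
    rw [integral_const_mul, (key t).2]
  · intro t
    exact (Integrable.of_bound (measurable_snd.comp (measurable_pi_apply t)).aestronglyMeasurable
      q (key t).1).const_mul _
  · refine Summable.of_nonneg_of_le (fun t => integral_nonneg fun ω => norm_nonneg _) (fun t => ?_)
      ((summable_geometric_of_lt_one h0.le h1).mul_right q)
    simp only [norm_mul, integral_const_mul]
    rw [Real.norm_of_nonneg (by positivity)]
    gcongr
    refine (le_abs_self _).trans (abs_integral_le_of_abs_le _ ?_)
    filter_upwards [(key t).1] with ω hω
    simpa using hω

variable {M} {q : ℝ} (hR : ∀ x, ∀ᵐ y ∂(M.R x), |y| ≤ q)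
include hR

lemma Q_eq_integral_occupation (x : S × A) :
    Q M π x = ∫ y, meanReward M y ∂(occupation M π x) := by
  have h := integral_discounted_reward π hR (Measure.dirac x)
  rw [Measure.dirac_bind (Kernel.measurable _), Measure.dirac_bind (Kernel.measurable _)] at h
  exact h

lemma measurable_Q : Measurable (Q M π) := by
  rw [funext (Q_eq_integral_occupation π hR)]
  exact measurable_integral_kernel (measurable_meanReward M) _

lemma abs_Q_le (x : S × A) : |Q M π x| ≤ q := by
  rw [Q_eq_integral_occupation π hR]
  exact abs_integral_le_of_abs_le _ (ae_of_all _ (abs_meanReward_le hR))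

lemma integral_Q (α : Measure (S × A)) [IsProbabilityMeasure α] :
    ∫ x, Q M π x ∂α = ∫ x, meanReward M x ∂(occupation M π ∘ₘ α) := by
  rw [integral_comp_measure (measurable_meanReward M) (abs_meanReward_le hR)]
  simp only [Q_eq_integral_occupation π hR]

lemma V_eq_integral_Q (s : S) : V M π s = ∫ a, Q M π (s, a) ∂(π.kernel s) := by
  have h := integral_discounted_reward π hR (Measure.dirac s ⊗ₘ π.kernel)
  rw [← actStep_comp, ← integral_Q π hR,
    integral_compProd_of_abs_le (measurable_Q π hR) (abs_Q_le π hR)] at h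
  rw [integral_dirac' _ _ (measurable_integral_kernel_prod (measurable_Q π hR)
    π.kernel).stronglyMeasurable] at h
  exact h

lemma measurable_V : Measurable (V M π) := by
  rw [funext (V_eq_integral_Q π hR)]
  exact measurable_integral_kernel_prod (measurable_Q π hR) _

lemma abs_V_le (s : S) : |V M π s| ≤ q := by
  rw [V_eq_integral_Q π hR]
  exact abs_integral_le_of_abs_le _ (ae_of_all _ fun a => abs_Q_le π hR _)

lemma measurable_advantage : Measurable (advantage M π) :=
  (measurable_Q π hR).sub ((measurable_V π hR).comp measurable_fst)

lemma abs_advantage_le (x : S × A) : |advantage M π x| ≤ 2 * q := by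
  have h1 := abs_Q_le π hR x
  have h2 := abs_V_le π hR x.1
  have h3 := abs_sub (Q M π x) (V M π x.1)
  unfold advantage
  linarith

omit hR in
lemma pairKernel_comp (α : Measure (S × A)) [IsFiniteMeasure α] :
    pairKernel M π ∘ₘ α = (M.P ∘ₘ α) ⊗ₘ π.kernel := by
  rw [Measure.compProd_eq_comp_prod, Measure.comp_assoc]; rfl

omit hR in
lemma pairKernel_apply (x : S × A) : pairKernel M π x = M.P x ⊗ₘ π.kernel := by
  rw [Measure.compProd_eq_comp_prod]; rfl

omit hR in
lemma map_fst_pairKernel_comp (α : Measure (S × A)) [IsFiniteMeasure α] :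
    (pairKernel M π ∘ₘ α).map Prod.fst = M.P ∘ₘ α := by
  rw [pairKernel_comp]; exact Measure.fst_compProd _ _

/-- The Bellman equation `Q^π(s, a) = (1 - γ) E[r(s, a)] + γ E_{s' ∼ P(· | s, a)}[V^π(s')]`. -/
lemma Q_bellman (x : S × A) :
    Q M π x = (1 - M.γ) * meanReward M x + M.γ * ∫ s, V M π s ∂(M.P x) := by
  have h := resolvent_comp_eq' (pairKernel M π) M.γ_pos (Measure.dirac x)
  rw [Measure.dirac_bind (Kernel.measurable _), Measure.dirac_bind (Kernel.measurable _)] at h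
  rw [Q_eq_integral_occupation π hR, occupation, h,
    integral_discount_add M.γ_pos M.γ_lt_one (measurable_meanReward M) (abs_meanReward_le hR),
    integral_dirac' _ _ (measurable_meanReward M).stronglyMeasurable, ← integral_Q π hR,
    pairKernel_apply, integral_compProd_of_abs_le (measurable_Q π hR) (abs_Q_le π hR)]
  simp only [V_eq_integral_Q π hR]

end Values

/-! ### Visitation measures, the flow equation and performance differences -/

section Visitation

variable {S A : Type*} [MeasurableSpace S] [MeasurableSpace A] (M : MDP S A) (π : Policy S A)

lemma pairKernel_pow_zero_comp {M : MDP S A} {π : Policy S A} (α : Measure (S × A)) :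
    ⇑(pairKernel M π ^ 0) ∘ₘ α = α := by
  rw [pow_zero]; exact Measure.id_comp

lemma pairKernel_pow_succ_comp {M : MDP S A} {π : Policy S A} (α : Measure (S × A))
    (t : ℕ) :
    ⇑(pairKernel M π ^ (t + 1)) ∘ₘ α = pairKernel M π ∘ₘ (⇑(pairKernel M π ^ t) ∘ₘ α) := by
  rw [Measure.comp_assoc, pow_succ']; rfl

/-- At every time the action is drawn from the policy. -/
lemma pairKernel_pow_comp_compProd (μ : Measure S) [IsProbabilityMeasure μ] (t : ℕ) :
    ⇑(pairKernel M π ^ t) ∘ₘ (μ ⊗ₘ π.kernel) =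
      ((⇑(pairKernel M π ^ t) ∘ₘ (μ ⊗ₘ π.kernel)).map Prod.fst) ⊗ₘ π.kernel := by
  cases t with
  | zero =>
    rw [pairKernel_pow_zero_comp]
    exact congrArg (· ⊗ₘ π.kernel) (Measure.fst_compProd μ π.kernel).symm
  | succ t =>
    rw [pairKernel_pow_succ_comp, map_fst_pairKernel_comp, pairKernel_comp]

instance (μ : Measure S) [IsProbabilityMeasure μ] :
    IsProbabilityMeasure (trajLawState M π μ) := by
  unfold trajLawState; infer_instance

lemma map_pair_trajLawState (μ : Measure S) [IsProbabilityMeasure μ] (t : ℕ) :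
    (trajLawState M π μ).map (fun ω => (ω t).1) =
      ⇑(pairKernel M π ^ t) ∘ₘ (μ ⊗ₘ π.kernel) := by
  have h := map_eval_trajLaw M π (μ ⊗ₘ π.kernel) t
  rw [← actStep_comp] at h
  rw [← map_fst_rewardStep_comp M (⇑(pairKernel M π ^ t) ∘ₘ (μ ⊗ₘ π.kernel)), ← h,
    Measure.map_map (by fun_prop) (by fun_prop)]
  rfl

lemma map_state_trajLawState (μ : Measure S) [IsProbabilityMeasure μ] (t : ℕ) :
    (trajLawState M π μ).map (fun ω => (ω t).1.1) =
      (⇑(pairKernel M π ^ t) ∘ₘ (μ ⊗ₘ π.kernel)).map Prod.fst := by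
  rw [← map_pair_trajLawState, Measure.map_map (by fun_prop) (by fun_prop)]
  rfl

/-- The policy built into `visitation` is consistent with the law of the pairs `(sₜ, aₜ)`. -/
lemma visitation_eq : visitation M π = occupation M π ∘ₘ (M.ζ ⊗ₘ π.kernel) := by
  rw [visitation, stateVisitation, resolvent_comp, Measure.compProd_sum_left]
  congr with t : 1
  rw [Measure.compProd_smul_left, map_state_trajLawState, ← pairKernel_pow_comp_compProd]

lemma visitationFrom_eq (x : S × A) :
    visitationFrom M π x = occupation M π ∘ₘ (M.P x ⊗ₘ π.kernel) := by
  rw [visitationFrom, resolvent_comp]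
  simp only [map_pair_trajLawState]

instance : IsProbabilityMeasure (visitation M π) := by
  rw [visitation_eq]; infer_instance

instance : SFinite (stateVisitation M π) := by
  unfold stateVisitation; infer_instance

lemma stateVisitation_eq : stateVisitation M π = (visitation M π).map Prod.fst :=
  (Measure.fst_compProd _ _).symm

instance : IsProbabilityMeasure (stateVisitation M π) := by
  rw [stateVisitation_eq]; exact Measure.isProbabilityMeasure_map (by fun_prop)

/-- The flow equation `ν = (1 - γ) ζ + γ P σ` of the visitation measures. -/
lemma stateVisitation_flow : stateVisitation M π =
    ENNReal.ofReal (1 - M.γ) • M.ζ + ENNReal.ofReal M.γ • (M.P ∘ₘ visitation M π) := by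
  rw [stateVisitation_eq, visitation_eq]
  have h := congrArg (fun m => Measure.map Prod.fst m)
    (resolvent_comp_eq (pairKernel M π) M.γ_pos (M.ζ ⊗ₘ π.kernel))
  simp only [Measure.map_add _ _ measurable_fst, Measure.map_smul, map_fst_pairKernel_comp] at h
  rw [h]
  congr 2
  exact Measure.fst_compProd _ _

lemma integral_stateVisitation_flow {v : S → ℝ} {C : ℝ} (hv : Measurable v)
    (hC : ∀ s, |v s| ≤ C) :
    ∫ s, v s ∂(stateVisitation M π) =
      (1 - M.γ) * ∫ s, v s ∂M.ζ + M.γ * ∫ x, ∫ s, v s ∂(M.P x) ∂(visitation M π) := by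
  rw [stateVisitation_flow, integral_discount_add M.γ_pos M.γ_lt_one hv hC,
    integral_comp_measure hv hC]

lemma integral_visitation {f : S × A → ℝ} {C : ℝ} (hf : Measurable f) (hC : ∀ x, |f x| ≤ C) :
    ∫ x, f x ∂(visitation M π) = ∫ s, ∫ a, f (s, a) ∂(π.kernel s) ∂(stateVisitation M π) :=
  integral_compProd_of_abs_le hf hC _ _

/-- The same Markov decision process with another initial distribution. -/
noncomputable def MDP.withInit (μ : Measure S) [IsProbabilityMeasure μ] : MDP S A :=
  { M with ζ := μ, isProbabilityMeasure_ζ := inferInstance }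

/-- This turns every statement about `visitation` into one about `visitationFrom`. -/
lemma visitationFrom_eq_visitation (x : S × A) :
    visitationFrom M π x = visitation (M.withInit (M.P x)) π := by
  rw [visitationFrom_eq, visitation_eq]; rfl

/-- The performance difference lemma:
`J(π') - J(π) = (1 - γ)⁻¹ E_{(s, a) ∼ σ_{π'}}[A^π(s, a)]`. -/
lemma performance_difference {q : ℝ} (hR : ∀ x, ∀ᵐ y ∂(M.R x), |y| ≤ q) (π' : Policy S A) :
    (1 - M.γ) * (J M π' - J M π) = ∫ x, advantage M π x ∂(visitation M π') := by
  have hV := measurable_V π hR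
  have hVb := abs_V_le π hR
  have hQ := measurable_Q π hR
  have hQb := abs_Q_le π hR
  have hJ' : J M π' = ∫ x, meanReward M x ∂(visitation M π') := by
    rw [visitation_eq, ← integral_Q π' hR,
      integral_compProd_of_abs_le (measurable_Q π' hR) (abs_Q_le π' hR)]
    simp only [← V_eq_integral_Q π' hR, J]
  have hflow := integral_stateVisitation_flow M π' hV hVb
  rw [stateVisitation_eq, integral_map (by fun_prop) hV.aestronglyMeasurable] at hflow
  have hVi : Integrable (fun x : S × A => V M π x.1) (visitation M π') :=
    integrable_of_abs_le (hV.comp measurable_fst) (fun x => hVb x.1) _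
  simp only [advantage]
  rw [integral_sub (integrable_of_abs_le hQ hQb _) hVi, hflow]
  simp only [Q_bellman π hR]
  rw [integral_add, integral_const_mul, integral_const_mul, hJ', J]
  · ring
  · exact (integrable_of_abs_le (measurable_meanReward M) (abs_meanReward_le hR) _).const_mul _
  · exact (integrable_of_abs_le (measurable_integral_kernel hV M.P)
      (fun x => abs_integral_le_of_abs_le _ (ae_of_all _ hVb)) _).const_mul _

end Visitation

/-! ### Perturbation of softmax vectors -/

section Softmax

variable {A : Type*} [Fintype A] [Nonempty A]

/-- The probability vector proportional to `exp f`. -/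
noncomputable def softmax (f : A → ℝ) (a : A) : ℝ := Real.exp (f a) / ∑ b, Real.exp (f b)

lemma sum_exp_pos (f : A → ℝ) : 0 < ∑ b, Real.exp (f b) :=
  Finset.sum_pos (fun _ _ => Real.exp_pos _) Finset.univ_nonempty

lemma softmax_pos (f : A → ℝ) (a : A) : 0 < softmax f a :=
  div_pos (Real.exp_pos _) (sum_exp_pos f)

lemma sum_softmax (f : A → ℝ) : ∑ a, softmax f a = 1 := by
  unfold softmax; rw [← Finset.sum_div, div_self (sum_exp_pos f).ne']

lemma abs_sum_softmax_mul_le (f : A → ℝ) {w : A → ℝ} {c : ℝ} (hw : ∀ a, |w a| ≤ c) :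
    |∑ a, softmax f a * w a| ≤ c := by
  calc |∑ a, softmax f a * w a| ≤ ∑ a, softmax f a * c := by
        refine (Finset.abs_sum_le_sum_abs _ _).trans (Finset.sum_le_sum fun a _ => ?_)
        rw [abs_mul, abs_of_pos (softmax_pos f a)]
        exact mul_le_mul_of_nonneg_left (hw a) (softmax_pos f a).le
    _ = c := by rw [← Finset.sum_mul, sum_softmax, one_mul]

/-- Exponential tilting of a softmax vector. -/
lemma softmax_eq_tilt (f g : A → ℝ) (a : A) :
    softmax g a = softmax f a * Real.exp (g a - f a) /
      ∑ b, softmax f b * Real.exp (g b - f b) := by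
  have h : ∀ b, softmax f b * Real.exp (g b - f b) = Real.exp (g b) / ∑ c, Real.exp (f c) := by
    intro b
    rw [softmax, div_mul_eq_mul_div, ← Real.exp_add]
    congr 2; ring
  simp only [h]
  rw [← Finset.sum_div, div_div_div_cancel_right₀ (sum_exp_pos f).ne', softmax]

/-- The normalizing factor of the tilt is bounded below and close to `1`. -/
lemma softmax_tilt_bounds {f g : A → ℝ} {ε : ℝ} (hε : ε ≤ 1) (hfg : ∀ a, |g a - f a| ≤ ε) :
    1 / 3 ≤ ∑ b, softmax f b * Real.exp (g b - f b) ∧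
      |∑ b, softmax f b * Real.exp (g b - f b) - 1| ≤ 2 * ε := by
  constructor
  · calc (1 : ℝ) / 3 ≤ Real.exp (-1) := by
          rw [Real.exp_neg, one_div]
          exact inv_anti₀ (Real.exp_pos 1) (Real.exp_one_lt_three.le)
      _ = ∑ b, softmax f b * Real.exp (-1) := by rw [← Finset.sum_mul, sum_softmax, one_mul]
      _ ≤ _ := by
          refine Finset.sum_le_sum fun b _ => mul_le_mul_of_nonneg_left ?_ (softmax_pos f b).le
          exact Real.exp_le_exp.2 (by linarith [neg_abs_le (g b - f b), hfg b])
  · have h : ∑ b, softmax f b * Real.exp (g b - f b) - 1 =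
        ∑ b, softmax f b * (Real.exp (g b - f b) - 1) := by
      simp only [mul_sub, Finset.sum_sub_distrib, mul_one, sum_softmax]
    rw [h]
    refine abs_sum_softmax_mul_le f fun b => ?_
    exact (Real.abs_exp_sub_one_le ((hfg b).trans hε)).trans (by linarith [hfg b])

lemma sum_abs_softmax_sub_le {f g : A → ℝ} {ε : ℝ} (hε : ε ≤ 1)
    (hfg : ∀ a, |g a - f a| ≤ ε) : ∑ a, |softmax g a - softmax f a| ≤ 12 * ε := by
  obtain ⟨hZ, hZ1⟩ := softmax_tilt_bounds hε hfg
  have key : ∀ a, |softmax g a - softmax f a| ≤ softmax f a * (12 * ε) := by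
    intro a
    rw [softmax_eq_tilt f g a]
    set Z := ∑ b, softmax f b * Real.exp (g b - f b)
    have hZ0 : 0 < Z := by linarith
    have h1 : softmax f a * Real.exp (g a - f a) / Z - softmax f a =
        softmax f a * ((Real.exp (g a - f a) - 1 - (Z - 1)) / Z) := by field_simp; ring
    rw [h1, abs_mul, abs_of_pos (softmax_pos f a)]
    refine mul_le_mul_of_nonneg_left ?_ (softmax_pos f a).le
    rw [abs_div, abs_of_pos hZ0, div_le_iff₀ hZ0]
    have h2 := Real.abs_exp_sub_one_le ((hfg a).trans hε)
    have h3 := abs_sub (Real.exp (g a - f a) - 1) (Z - 1)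
    have h4 := (abs_nonneg _).trans (hfg a)
    nlinarith [hfg a]
  calc _ ≤ ∑ a, softmax f a * (12 * ε) := Finset.sum_le_sum fun a _ => key a
    _ = _ := by rw [← Finset.sum_mul, sum_softmax, one_mul]

/-- Second-order expansion of the expectation of a centred function under a softmax vector. -/
lemma softmax_expansion {f g w : A → ℝ} {ε c : ℝ} (hε : ε ≤ 1) (hfg : ∀ a, |g a - f a| ≤ ε)
    (hw : ∀ a, |w a| ≤ c) (hw0 : ∑ a, softmax f a * w a = 0) :
    |∑ a, softmax g a * w a - ∑ a, softmax f a * (w a * (g a - f a))| ≤ 13 * c * ε ^ 2 := by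
  obtain ⟨hZ, hZ1⟩ := softmax_tilt_bounds hε hfg
  simp only [softmax_eq_tilt f g]
  set Z := ∑ b, softmax f b * Real.exp (g b - f b)
  have hZ0 : 0 < Z := by linarith
  obtain ⟨a₀⟩ := ‹Nonempty A›
  have hε0 : 0 ≤ ε := (abs_nonneg _).trans (hfg a₀)
  have hc0 : 0 ≤ c := (abs_nonneg _).trans (hw a₀)
  set T := ∑ a, softmax f a * (Real.exp (g a - f a) * w a) with hT
  have hT1 : T = ∑ a, softmax f a * ((Real.exp (g a - f a) - 1) * w a) := by
    simp only [sub_mul, mul_sub, one_mul, Finset.sum_sub_distrib, hw0, sub_zero, hT]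
  have hTb : |T| ≤ 2 * ε * c := by
    rw [hT1]
    refine abs_sum_softmax_mul_le f fun a => ?_
    rw [abs_mul]
    refine mul_le_mul ?_ (hw a) (abs_nonneg _) (by positivity)
    exact (Real.abs_exp_sub_one_le ((hfg a).trans hε)).trans (by linarith [hfg a])
  have hT2 : |T - ∑ a, softmax f a * (w a * (g a - f a))| ≤ ε ^ 2 * c := by
    have : T - ∑ a, softmax f a * (w a * (g a - f a)) =
        ∑ a, softmax f a * ((Real.exp (g a - f a) - 1 - (g a - f a)) * w a) := by
      rw [hT1, ← Finset.sum_sub_distrib]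
      exact Finset.sum_congr rfl fun a _ => by ring
    rw [this]
    refine abs_sum_softmax_mul_le f fun a => ?_
    rw [abs_mul]
    refine mul_le_mul ?_ (hw a) (abs_nonneg _) (by positivity)
    refine (Real.abs_exp_sub_one_sub_id_le ((hfg a).trans hε)).trans ?_
    exact sq_le_sq' (by linarith [neg_abs_le (g a - f a), hfg a])
      ((le_abs_self _).trans (hfg a))
  have h1 : ∑ a, softmax f a * Real.exp (g a - f a) / Z * w a = T / Z := by
    rw [hT, Finset.sum_div]
    exact Finset.sum_congr rfl fun a _ => by ring
  have h2 : |T / Z - T| ≤ 12 * c * ε ^ 2 := by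
    have : T / Z - T = T * (-(Z - 1) / Z) := by field_simp; ring
    rw [this, abs_mul]
    calc |T| * |-(Z - 1) / Z| ≤ (2 * ε * c) * (6 * ε) := by
          refine mul_le_mul hTb ?_ (abs_nonneg _) (by positivity)
          rw [abs_div, abs_neg, abs_of_pos hZ0, div_le_iff₀ hZ0]
          nlinarith
      _ = _ := by ring
  rw [h1]
  calc _ = |(T / Z - T) + (T - ∑ a, softmax f a * (w a * (g a - f a)))| := by congr 1; ring
    _ ≤ _ := abs_add_le _ _
    _ ≤ 12 * c * ε ^ 2 + ε ^ 2 * c := add_le_add h2 hT2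
    _ = _ := by ring

end Softmax

/-! ### Perturbation of policies -/

section Perturbation

variable {S A : Type*} [MeasurableSpace S] [Fintype A] [MeasurableSpace A]
  [MeasurableSingletonClass A]

lemma integral_policy (π : Policy S A) (s : S) (u : A → ℝ) :
    ∫ a, u a ∂(π.kernel s) = ∑ a, (π.kernel s).real {a} * u a := by
  rw [integral_fintype Integrable.of_finite]
  simp only [smul_eq_mul]

lemma measureReal_energyPolicy [Nonempty A] (f : S × A → ℝ) (hf : Measurable f) (s : S) (a : A) :
    ((energyPolicy f hf).kernel s).real {a} = softmax (fun b => f (s, b)) a := by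
  classical
  have h : (energyPolicy f hf).kernel s = ∑ a, ENNReal.ofReal
        (Real.exp (f (s, a)) / ∑ a', Real.exp (f (s, a'))) • Measure.dirac a := rfl
  rw [h, measureReal_def]
  simp only [Measure.coe_finsetSum, Finset.sum_apply, Measure.smul_apply, smul_eq_mul,
    Measure.dirac_apply' _ (measurableSet_singleton a), Set.indicator_apply,
    Set.mem_singleton_iff, Pi.one_apply, mul_ite, mul_one, mul_zero, Finset.sum_ite_eq',
    Finset.mem_univ, if_true]
  exact ENNReal.toReal_ofReal (softmax_pos (fun b => f (s, b)) a).le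

lemma integral_energyPolicy [Nonempty A] (f : S × A → ℝ) (hf : Measurable f) (s : S)
    (u : A → ℝ) : ∫ a, u a ∂((energyPolicy f hf).kernel s) =
      ∑ a, softmax (fun b => f (s, b)) a * u a := by
  simp only [integral_policy, measureReal_energyPolicy]

lemma abs_integral_policy_sub_le {π π' : Policy S A} {s : S} {δ c : ℝ}
    (hδ : ∑ a, |(π'.kernel s).real {a} - (π.kernel s).real {a}| ≤ δ) {u : A → ℝ}
    (hc0 : 0 ≤ c) (hu : ∀ a, |u a| ≤ c) :
    |∫ a, u a ∂(π'.kernel s) - ∫ a, u a ∂(π.kernel s)| ≤ δ * c := by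
  rw [integral_policy, integral_policy, ← Finset.sum_sub_distrib]
  calc _ ≤ ∑ a, |(π'.kernel s).real {a} - (π.kernel s).real {a}| * c := by
        refine (Finset.abs_sum_le_sum_abs _ _).trans (Finset.sum_le_sum fun a _ => ?_)
        rw [← sub_mul, abs_mul]
        exact mul_le_mul_of_nonneg_left (hu a) (abs_nonneg _)
    _ ≤ _ := by rw [← Finset.sum_mul]; exact mul_le_mul_of_nonneg_right hδ hc0

variable (M : MDP S A)

/-- The state visitation measure is Lipschitz in the policy, for the total variation distance:
a bound `b` on the Lipschitz defect can be improved to `γ (δ + b)` by the flow equation. -/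
lemma abs_integral_stateVisitation_sub_le {π π' : Policy S A} {δ : ℝ}
    (hδ : ∀ s, ∑ a, |(π'.kernel s).real {a} - (π.kernel s).real {a}| ≤ δ) {w : S → ℝ} {c : ℝ}
    (hw : Measurable w) (hc0 : 0 ≤ c) (hwc : ∀ s, |w s| ≤ c) :
    |∫ s, w s ∂(stateVisitation M π') - ∫ s, w s ∂(stateVisitation M π)| ≤
      M.γ * δ / (1 - M.γ) * c := by
  have h0 := M.γ_pos
  have h1 := M.γ_lt_one
  have h1' : 0 < 1 - M.γ := by linarith
  have iter : ∀ n : ℕ, ∀ w : S → ℝ, Measurable w → (∀ s, |w s| ≤ c) →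
      |∫ s, w s ∂(stateVisitation M π') - ∫ s, w s ∂(stateVisitation M π)| ≤
        (2 * M.γ ^ n + M.γ * δ / (1 - M.γ)) * c := by
    intro n
    induction n with
    | zero =>
      intro w hw hwc
      obtain ⟨s₀⟩ := nonempty_of_isProbabilityMeasure M.ζ
      have hδ0 : 0 ≤ δ := (Finset.sum_nonneg fun a _ => abs_nonneg _).trans (hδ s₀)
      -- two probability measures are at total variation distance at most `2`
      have e1 := abs_integral_le_of_abs_le (stateVisitation M π') (ae_of_all _ hwc)
      have e2 := abs_integral_le_of_abs_le (stateVisitation M π) (ae_of_all _ hwc)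
      have e3 : 0 ≤ M.γ * δ / (1 - M.γ) * c := by positivity
      refine (abs_sub _ _).trans ?_
      rw [pow_zero]
      linarith
    | succ n ih =>
      intro w hw hwc
      set u : S × A → ℝ := fun x => ∫ s, w s ∂(M.P x) with hu
      have hum : Measurable u := measurable_integral_kernel hw M.P
      have hub : ∀ x, |u x| ≤ c := fun x => abs_integral_le_of_abs_le _ (ae_of_all _ hwc)
      have hm := measurable_integral_kernel_prod hum π.kernel
      have hm' := measurable_integral_kernel_prod hum π'.kernel
      have hb : ∀ s, |∫ a, u (s, a) ∂(π.kernel s)| ≤ c := fun s =>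
        abs_integral_le_of_abs_le _ (ae_of_all _ fun a => hub _)
      have hb' : ∀ s, |∫ a, u (s, a) ∂(π'.kernel s)| ≤ c := fun s =>
        abs_integral_le_of_abs_le _ (ae_of_all _ fun a => hub _)
      rw [integral_stateVisitation_flow M π' hw hwc, integral_stateVisitation_flow M π hw hwc,
        integral_visitation M π' hum hub, integral_visitation M π hum hub]
      have e1 := ih _ hm hb
      -- change the policy first, then the visitation measure
      have e2 : |∫ s, ∫ a, u (s, a) ∂(π'.kernel s) ∂(stateVisitation M π') -
          ∫ s, ∫ a, u (s, a) ∂(π.kernel s) ∂(stateVisitation M π')| ≤ δ * c := by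
        rw [← integral_sub (integrable_of_abs_le hm' hb' _) (integrable_of_abs_le hm hb _)]
        exact abs_integral_le_of_abs_le _ (ae_of_all _ fun s =>
          abs_integral_policy_sub_le (hδ s) hc0 fun a => hub _)
      have e3 := abs_add_le _ _ |>.trans (add_le_add e2 e1)
      rw [sub_add_sub_cancel] at e3
      rw [add_sub_add_left_eq_sub, ← mul_sub, abs_mul, abs_of_pos h0]
      refine (mul_le_mul_of_nonneg_left e3 h0.le).trans (le_of_eq ?_)
      field_simp
      ring
  have hlim : Filter.Tendsto (fun n : ℕ => (2 * M.γ ^ n + M.γ * δ / (1 - M.γ)) * c)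
      Filter.atTop (nhds ((2 * 0 + M.γ * δ / (1 - M.γ)) * c)) :=
    (((tendsto_pow_atTop_nhds_zero_of_lt_one h0.le h1).const_mul 2).add_const _).mul_const _
  have := ge_of_tendsto' hlim fun n => iter n w hw hwc
  simpa using this

variable {M}

lemma integral_advantage_policy {q : ℝ} (hR : ∀ x, ∀ᵐ y ∂(M.R x), |y| ≤ q) (π : Policy S A)
    (s : S) : ∫ a, advantage M π (s, a) ∂(π.kernel s) = 0 := by
  simp only [advantage]
  rw [integral_sub Integrable.of_finite (integrable_const _), integral_const,
    V_eq_integral_Q π hR]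
  simp

variable [Nonempty A]

/-- The quadratic constant in the policy gradient expansion: `26 q` is the remainder of
`softmax_expansion` for an advantage bounded by `2 q`, and `288 q = 12 * (12 * (2 * q))` combines
the variation of the policy with the size of the integrand in the change of visitation
measure. -/
noncomputable def expansionConst (q γ : ℝ) : ℝ := (26 * q + γ / (1 - γ) * (288 * q)) / (1 - γ)

/-- The policy gradient theorem for energy-based policies, with a remainder that is quadratic in
the perturbation of the energy, uniformly in the initial distribution. -/
lemma abs_policy_gradient_remainder_le {q : ℝ} (hR : ∀ x, ∀ᵐ y ∂(M.R x), |y| ≤ q)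
    {f g : S × A → ℝ} (hf : Measurable f) (hg : Measurable g) {ε : ℝ} (hε : ε ≤ 1)
    (hfg : ∀ x, |g x - f x| ≤ ε) :
    |J M (energyPolicy g hg) - J M (energyPolicy f hf) - 1 / (1 - M.γ) *
        ∫ x, advantage M (energyPolicy f hf) x * (g x - f x) ∂(visitation M (energyPolicy f hf))|
      ≤ expansionConst q M.γ * ε ^ 2 := by
  have h1' : 0 < 1 - M.γ := by linarith [M.γ_lt_one]
  set π := energyPolicy f hf with hπ
  set π' := energyPolicy g hg with hπ'
  have hA := measurable_advantage π hR
  have hAb := abs_advantage_le π hR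
  obtain ⟨s₀⟩ := nonempty_of_isProbabilityMeasure M.ζ
  obtain ⟨a₀⟩ := ‹Nonempty A›
  have : Nonempty A := ⟨a₀⟩
  have hε0 : 0 ≤ ε := (abs_nonneg _).trans (hfg (s₀, a₀))
  have hq0 : 0 ≤ q := (abs_nonneg _).trans (abs_Q_le π hR (s₀, a₀))
  have hδ : ∀ s, ∑ a, |(π'.kernel s).real {a} - (π.kernel s).real {a}| ≤ 12 * ε := by
    intro s
    simp only [hπ, hπ', measureReal_energyPolicy]
    exact sum_abs_softmax_sub_le hε fun a => hfg _
  -- `D` is small because the advantage is centred under `π`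
  set D : S → ℝ := fun s => ∫ a, advantage M π (s, a) ∂(π'.kernel s) with hD
  have hDm : Measurable D := measurable_integral_kernel_prod hA _
  have hDb : ∀ s, |D s| ≤ 12 * ε * (2 * q) := by
    intro s
    have := abs_integral_policy_sub_le (hδ s) (by positivity : 0 ≤ 2 * q) (u := fun a =>
      advantage M π (s, a)) fun a => hAb _
    rwa [integral_advantage_policy hR, sub_zero] at this
  have hAu : Measurable fun x => advantage M π x * (g x - f x) := hA.mul (hg.sub hf)
  have hAub : ∀ x, |advantage M π x * (g x - f x)| ≤ 2 * q * ε := fun x => by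
    rw [abs_mul]; exact mul_le_mul (hAb x) (hfg x) (abs_nonneg _) (by positivity)
  have e1 : (1 - M.γ) * (J M π' - J M π) = ∫ s, D s ∂(stateVisitation M π') := by
    rw [performance_difference M π hR, integral_visitation M π' hA hAb]
  have e2 := abs_integral_stateVisitation_sub_le M hδ hDm (by positivity) hDb
  have e3 : |∫ s, D s ∂(stateVisitation M π) -
      ∫ x, advantage M π x * (g x - f x) ∂(visitation M π)| ≤ 13 * (2 * q) * ε ^ 2 := by
    rw [integral_visitation M π hAu hAub, ← integral_sub (integrable_of_abs_le hDm hDb _)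
      (integrable_of_abs_le (measurable_integral_kernel_prod hAu _)
        (fun s => abs_integral_le_of_abs_le _ (ae_of_all _ fun a => hAub _)) _)]
    refine abs_integral_le_of_abs_le _ (ae_of_all _ fun s => ?_)
    simp only [hD, hπ', hπ, integral_energyPolicy]
    refine softmax_expansion hε (fun a => hfg _) (fun a => hAb _) ?_
    have := integral_advantage_policy hR π s
    rwa [hπ, integral_energyPolicy] at this
  have e4 := (abs_add_le _ _).trans (add_le_add e2 e3)
  rw [sub_add_sub_cancel, ← e1] at e4
  have e5 : J M π' - J M π - 1 / (1 - M.γ) *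
        ∫ x, advantage M π x * (g x - f x) ∂(visitation M π) =
      ((1 - M.γ) * (J M π' - J M π) -
        ∫ x, advantage M π x * (g x - f x) ∂(visitation M π)) / (1 - M.γ) := by
    field_simp
  rw [e5, abs_div, abs_of_pos h1', div_le_iff₀ h1']
  refine e4.trans (le_of_eq ?_)
  unfold expansionConst
  field_simp
  ring

end Perturbation

/-! ### The Gibbs variational identity -/

section Gibbs

variable {A : Type*} [Fintype A] [Nonempty A]

lemma neg_log_softmax_le {f : A → ℝ} {c : ℝ} (hf : ∀ a, |f a| ≤ c) (a : A) :
    -Real.log (softmax f a) ≤ 2 * c + Real.log (Fintype.card A) := by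
  have hcard : (0 : ℝ) < Fintype.card A := by exact_mod_cast Fintype.card_pos
  have h1 : ∑ b, Real.exp (f b) ≤ Fintype.card A * Real.exp c := by
    refine (Finset.sum_le_card_nsmul _ _ (Real.exp c) fun b _ =>
      Real.exp_le_exp.2 ((le_abs_self _).trans (hf b))).trans (le_of_eq ?_)
    simp
  have h2 := Real.log_le_log (sum_exp_pos f) h1
  rw [Real.log_mul hcard.ne' (Real.exp_pos _).ne', Real.log_exp] at h2
  rw [softmax, Real.log_div (Real.exp_pos _).ne' (sum_exp_pos f).ne', Real.log_exp]
  linarith [neg_abs_le (f a), hf a]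

/-- Gibbs variational identity: the regularized linear objective is a constant minus the
divergence from the tilted softmax vector. -/
lemma regularized_objective_eq {η : ℝ} (hη : 0 < η) {p : A → ℝ} (hp : ∀ a, 0 ≤ p a)
    (hp1 : ∑ a, p a = 1) (f u : A → ℝ) :
    ∑ a, u a * p a - 1 / η * ∑ a, p a * Real.log (p a / softmax f a) =
      1 / η * Real.log (∑ b, softmax f b * Real.exp (η * u b)) -
        1 / η * ∑ a, p a * Real.log (p a / softmax (fun b => f b + η * u b) a) := by
  set g : A → ℝ := fun b => f b + η * u b with hg
  have hgf : ∀ b, g b - f b = η * u b := fun b => by simp [hg]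
  have htilt := softmax_eq_tilt f g
  simp only [hgf] at htilt
  set Z := ∑ b, softmax f b * Real.exp (η * u b)
  have hZ : 0 < Z := Finset.sum_pos (fun b _ => mul_pos (softmax_pos f b) (Real.exp_pos _))
    Finset.univ_nonempty
  have key : ∀ a, p a * Real.log (p a / softmax f a) =
      p a * Real.log (p a / softmax g a) + η * (u a * p a) - p a * Real.log Z := by
    intro a
    rcases (hp a).eq_or_lt with h0 | h0
    · simp [← h0]
    · rw [Real.log_div h0.ne' (softmax_pos f a).ne', Real.log_div h0.ne' (softmax_pos g a).ne',
        htilt a, Real.log_div (mul_pos (softmax_pos f a) (Real.exp_pos _)).ne' hZ.ne',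
        Real.log_mul (softmax_pos f a).ne' (Real.exp_pos _).ne', Real.log_exp]
      ring
  simp only [key]
  rw [Finset.sum_sub_distrib, Finset.sum_add_distrib, ← Finset.mul_sum, ← Finset.sum_mul, hp1]
  field_simp
  ring

end Gibbs

/-! ### Divergences on a finite type -/

section FiniteDivergence

variable {A : Type*} [MeasurableSpace A]

lemma absolutelyContinuous_of_singleton_pos {p q : Measure A} [IsFiniteMeasure q]
    (hq : ∀ a, 0 < q.real {a}) : p ≪ q := by
  refine Measure.AbsolutelyContinuous.mk fun B _ hB => ?_
  have : B = ∅ := by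
    by_contra h
    obtain ⟨a, ha⟩ := Set.nonempty_iff_ne_empty.2 h
    have h0 : q {a} = 0 := measure_mono_null (Set.singleton_subset_iff.2 ha) hB
    have := hq a
    rw [measureReal_def, h0] at this
    simp at this
  simp [this]

variable [Fintype A] [MeasurableSingletonClass A]

lemma toReal_klDiv_eq_sum {p q : Measure A} [IsProbabilityMeasure p] [IsProbabilityMeasure q]
    (hq : ∀ a, 0 < q.real {a}) : (InformationTheory.klDiv p q).toReal =
      ∑ a, p.real {a} * Real.log (p.real {a} / q.real {a}) := by
  have hpq : p ≪ q := absolutelyContinuous_of_singleton_pos hq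
  rw [InformationTheory.toReal_klDiv_of_measure_eq hpq (by simp),
    integral_fintype Integrable.of_finite]
  refine Finset.sum_congr rfl fun a _ => ?_
  have h : p {a} = p.rnDeriv q a * q {a} := by
    conv_lhs => rw [← Measure.withDensity_rnDeriv_eq p q hpq]
    rw [withDensity_apply _ (measurableSet_singleton a), lintegral_singleton]
  have h2 : p.real {a} = (p.rnDeriv q a).toReal * q.real {a} := by
    rw [measureReal_def, h, ENNReal.toReal_mul, measureReal_def]
  rw [smul_eq_mul, llr]
  congr 2
  rw [h2, mul_div_cancel_right₀ _ (hq a).ne']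

lemma klDiv_ne_top_of_singleton_pos {p q : Measure A} [IsProbabilityMeasure p]
    [IsProbabilityMeasure q] (hq : ∀ a, 0 < q.real {a}) : InformationTheory.klDiv p q ≠ ⊤ :=
  InformationTheory.klDiv_ne_top (absolutelyContinuous_of_singleton_pos hq) Integrable.of_finite

end FiniteDivergence

/-! ### Maximizers of the proximal objective -/

section Proximal

variable {S A : Type*} [MeasurableSpace S] [Fintype A] [Nonempty A] [MeasurableSpace A]
  [MeasurableSingletonClass A] {M : MDP S A}

lemma energyPolicy_singleton_pos (f : S × A → ℝ) (hf : Measurable f) (s : S) (a : A) :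
    0 < ((energyPolicy f hf).kernel s).real {a} := by
  rw [measureReal_energyPolicy]; exact softmax_pos _ _

omit [Nonempty A] [Fintype A] in
lemma measurable_policy_singleton (π : Policy S A) (a : A) :
    Measurable fun s => (π.kernel s).real {a} :=
  (π.kernel.measurable_coe (measurableSet_singleton a)).ennreal_toReal

omit [Nonempty A] in
lemma sum_policy_singleton (π : Policy S A) (s : S) : ∑ a, (π.kernel s).real {a} = 1 := by
  rw [← Finset.sum_congr rfl fun a _ => mul_one _, ← integral_policy π s fun _ => 1]
  simp

lemma toReal_klDiv_energyPolicy (π : Policy S A) (f : S × A → ℝ) (hf : Measurable f) (s : S) :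
    (InformationTheory.klDiv (π.kernel s) ((energyPolicy f hf).kernel s)).toReal =
      ∑ a, (π.kernel s).real {a} *
        Real.log ((π.kernel s).real {a} / softmax (fun b => f (s, b)) a) := by
  rw [toReal_klDiv_eq_sum (energyPolicy_singleton_pos f hf s)]
  simp only [measureReal_energyPolicy]

omit [Nonempty A] [MeasurableSingletonClass A] in
lemma measurable_softmax {f : S × A → ℝ} (hf : Measurable f) (a : A) :
    Measurable fun s => softmax (fun b => f (s, b)) a := by
  unfold softmax; fun_prop

/-- The divergence from an energy-based policy with bounded energy is bounded, since the
probabilities of such a policy are bounded below. -/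
lemma integrable_toReal_klDiv_energyPolicy (π : Policy S A) {f : S × A → ℝ} (hf : Measurable f)
    {c : ℝ} (hc : ∀ x, |f x| ≤ c) (μ : Measure S) [IsFiniteMeasure μ] :
    Integrable (fun s =>
      (InformationTheory.klDiv (π.kernel s) ((energyPolicy f hf).kernel s)).toReal) μ := by
  refine integrable_of_abs_le (C := 2 * c + Real.log (Fintype.card A)) ?_ (fun s => ?_) μ
  · simp only [toReal_klDiv_energyPolicy]
    refine Finset.measurable_sum _ fun a _ => (measurable_policy_singleton π a).mul ?_
    exact Real.measurable_log.comp ((measurable_policy_singleton π a).div (measurable_softmax hf a))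
  · rw [abs_of_nonneg ENNReal.toReal_nonneg, toReal_klDiv_energyPolicy]
    rw [← one_mul (2 * c + _), ← sum_policy_singleton π s, Finset.sum_mul]
    refine Finset.sum_le_sum fun a _ => ?_
    rcases (measureReal_nonneg (μ := π.kernel s) (s := {a})).eq_or_lt with h0 | h0
    · simp [← h0]
    · refine mul_le_mul_of_nonneg_left ?_ h0.le
      rw [Real.log_div h0.ne' (softmax_pos _ a).ne']
      have h1 := neg_log_softmax_le (f := fun b => f (s, b)) (fun b => hc _) a
      have h2 : Real.log ((π.kernel s).real {a}) ≤ 0 :=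
        Real.log_nonpos h0.le measureReal_le_one
      linarith

variable {q : ℝ} (hR : ∀ x, ∀ᵐ y ∂(M.R x), |y| ≤ q) {η : ℝ} (hη : 0 < η) {f : S × A → ℝ}
  (hf : Measurable f) {c : ℝ} (hc : ∀ x, |f x| ≤ c)
include hR hη hc

/-- Up to a constant, the objective of a proximal step is minus the expected divergence from the
tilted energy-based policy. -/
lemma ppoObjective_eq
    (hg : Measurable fun x => f x + η * Q M (energyPolicy f hf) x) (π : Policy S A) :
    ppoObjective M η (energyPolicy f hf) π =
      ppoObjective M η (energyPolicy f hf) (energyPolicy _ hg) -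
      1 / η * ∫ s, (InformationTheory.klDiv (π.kernel s) ((energyPolicy _ hg).kernel s)).toReal
        ∂(stateVisitation M (energyPolicy f hf)) := by
  have hQ := measurable_Q (energyPolicy f hf) hR
  have hQb := abs_Q_le (energyPolicy f hf) hR
  have hgb : ∀ x, |f x + η * Q M (energyPolicy f hf) x| ≤ c + η * q := fun x => by
    refine (abs_add_le _ _).trans (add_le_add (hc x) ?_)
    rw [abs_mul, abs_of_pos hη]
    exact mul_le_mul_of_nonneg_left (hQb x) hη.le
  set Z : S → ℝ := fun s => 1 / η *
    Real.log (∑ b, softmax (fun b => f (s, b)) b *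
      Real.exp (η * Q M (energyPolicy f hf) (s, b))) with hZ
  have point : ∀ (π : Policy S A) s, (∑ a, Q M (energyPolicy f hf) (s, a) * (π.kernel s).real {a})
      - 1 / η * (InformationTheory.klDiv (π.kernel s) ((energyPolicy f hf).kernel s)).toReal =
      Z s - 1 / η * (InformationTheory.klDiv (π.kernel s)
        ((energyPolicy _ hg).kernel s)).toReal := by
    intro π s
    rw [toReal_klDiv_energyPolicy, toReal_klDiv_energyPolicy]
    exact regularized_objective_eq hη (fun a => measureReal_nonneg) (sum_policy_singleton π s) _ _
  have hself : ∀ s, Z s =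
      (∑ a, Q M (energyPolicy f hf) (s, a) * ((energyPolicy _ hg).kernel s).real {a}) -
      1 / η * (InformationTheory.klDiv ((energyPolicy _ hg).kernel s)
        ((energyPolicy f hf).kernel s)).toReal := by
    intro s
    rw [point, InformationTheory.klDiv_self]
    simp
  have hZi : Integrable Z (stateVisitation M (energyPolicy f hf)) := by
    rw [funext hself]
    refine Integrable.sub ?_ ((integrable_toReal_klDiv_energyPolicy _ hf hc _).const_mul _)
    refine integrable_finsetSum _ fun a _ => ?_
    refine integrable_of_abs_le (C := q * 1) ((hQ.comp measurable_prodMk_right).mul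
      (measurable_policy_singleton _ a)) (fun s => ?_) _
    rw [Pi.mul_apply, abs_mul]
    refine mul_le_mul (hQb _) ?_ (abs_nonneg _) ((abs_nonneg _).trans (hQb (s, a)))
    rw [abs_of_nonneg measureReal_nonneg]
    exact measureReal_le_one
  have e1 : ppoObjective M η (energyPolicy f hf) (energyPolicy _ hg) =
      ∫ s, Z s ∂(stateVisitation M (energyPolicy f hf)) :=
    integral_congr_ae (ae_of_all _ fun s => (hself s).symm)
  have e2 : ppoObjective M η (energyPolicy f hf) π =
      ∫ s, (Z s - 1 / η * (InformationTheory.klDiv (π.kernel s)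
        ((energyPolicy _ hg).kernel s)).toReal) ∂(stateVisitation M (energyPolicy f hf)) :=
    integral_congr_ae (ae_of_all _ fun s => point π s)
  rw [e1, e2, integral_sub hZi ((integrable_toReal_klDiv_energyPolicy _ hg hgb _).const_mul _),
    integral_const_mul (1 / η) fun s => (InformationTheory.klDiv (π.kernel s)
      ((energyPolicy _ hg).kernel s)).toReal]

lemma isPPOStep_energyPolicy (hg : Measurable fun x => f x + η * Q M (energyPolicy f hf) x) :
    IsPPOStep M η (energyPolicy f hf) (energyPolicy _ hg) := by
  intro π
  rw [ppoObjective_eq hR hη hf hc hg π]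
  have : 0 ≤ 1 / η * ∫ s, (InformationTheory.klDiv (π.kernel s)
      ((energyPolicy _ hg).kernel s)).toReal ∂(stateVisitation M (energyPolicy f hf)) :=
    mul_nonneg (by positivity) (integral_nonneg fun s => ENNReal.toReal_nonneg)
  linarith

/-- Maximizers of a proximal step are unique up to null sets of the state visitation measure. -/
lemma IsPPOStep.ae_eq {π : Policy S A} (h : IsPPOStep M η (energyPolicy f hf) π)
    (hg : Measurable fun x => f x + η * Q M (energyPolicy f hf) x) :
    (energyPolicy _ hg).kernel =ᵐ[stateVisitation M (energyPolicy f hf)] π.kernel := by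
  have h1 := h (energyPolicy _ hg)
  rw [ppoObjective_eq hR hη hf hc hg π] at h1
  have hgb : ∀ x, |f x + η * Q M (energyPolicy f hf) x| ≤ c + η * q := fun x => by
    refine (abs_add_le _ _).trans (add_le_add (hc x) ?_)
    rw [abs_mul, abs_of_pos hη]
    exact mul_le_mul_of_nonneg_left (abs_Q_le _ hR x) hη.le
  have hi := integrable_toReal_klDiv_energyPolicy π hg hgb (stateVisitation M (energyPolicy f hf))
  have h2 : ∫ s, (InformationTheory.klDiv (π.kernel s) ((energyPolicy _ hg).kernel s)).toReal
      ∂(stateVisitation M (energyPolicy f hf)) = 0 := by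
    refine le_antisymm ?_ (integral_nonneg fun s => ENNReal.toReal_nonneg)
    have hη' : 0 < 1 / η := by positivity
    by_contra hneg
    have := mul_pos hη' (not_le.1 hneg)
    linarith
  rw [integral_eq_zero_iff_of_nonneg (fun s => ENNReal.toReal_nonneg) hi] at h2
  filter_upwards [h2] with s hs
  have h3 := (ENNReal.toReal_eq_zero_iff _).1 hs
  exact (InformationTheory.klDiv_eq_zero_iff.1 (h3.resolve_right
    (klDiv_ne_top_of_singleton_pos (energyPolicy_singleton_pos _ hg s)))).symm

end Proximal

/-! ### Policies that agree on the visited states -/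

section AlmostEverywhere

variable {S A : Type*} [MeasurableSpace S] [MeasurableSpace A] {M : MDP S A} {π π' : Policy S A}

lemma stateVisitation_eq_sum : stateVisitation M π =
    Measure.sum fun t : ℕ => ENNReal.ofReal ((1 - M.γ) * M.γ ^ t) •
      (⇑(pairKernel M π ^ t) ∘ₘ (M.ζ ⊗ₘ π.kernel)).map Prod.fst := by
  simp only [stateVisitation, map_state_trajLawState]

lemma map_fst_absolutelyContinuous_stateVisitation (t : ℕ) :
    (⇑(pairKernel M π ^ t) ∘ₘ (M.ζ ⊗ₘ π.kernel)).map Prod.fst ≪ stateVisitation M π := by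
  have h1' : 0 < 1 - M.γ := by linarith [M.γ_lt_one]
  have h0 := M.γ_pos
  refine Measure.AbsolutelyContinuous.mk fun B hB h => ?_
  rw [stateVisitation_eq_sum, Measure.sum_apply_eq_zero' hB] at h
  have := h t
  rw [Measure.smul_apply, smul_eq_mul, mul_eq_zero] at this
  refine this.resolve_left ?_
  rw [ENNReal.ofReal_eq_zero, not_le]
  positivity

/-- Every policy visits only states that are visited by a policy whose action distributions
dominate its own. -/
lemma stateVisitation_absolutelyContinuous (h : ∀ s, π'.kernel s ≪ π.kernel s) :
    stateVisitation M π' ≪ stateVisitation M π := by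
  have key : ∀ t : ℕ, ⇑(pairKernel M π' ^ t) ∘ₘ (M.ζ ⊗ₘ π'.kernel) ≪
      ⇑(pairKernel M π ^ t) ∘ₘ (M.ζ ⊗ₘ π.kernel) := by
    intro t
    induction t with
    | zero =>
      rw [pairKernel_pow_zero_comp, pairKernel_pow_zero_comp]
      exact Measure.AbsolutelyContinuous.compProd_right (ae_of_all _ h)
    | succ t ih =>
      rw [pairKernel_pow_succ_comp, pairKernel_pow_succ_comp, pairKernel_comp, pairKernel_comp]
      exact Measure.AbsolutelyContinuous.compProd (ih.comp_right _) (ae_of_all _ h)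
  refine Measure.AbsolutelyContinuous.mk fun B hB hz => ?_
  rw [stateVisitation_eq_sum, Measure.sum_apply_eq_zero' hB]
  intro t
  rw [Measure.smul_apply, smul_eq_mul, mul_eq_zero]
  exact Or.inr (((key t).map measurable_fst).trans
    (map_fst_absolutelyContinuous_stateVisitation t) hz)

lemma initial_absolutelyContinuous_stateVisitation : M.ζ ≪ stateVisitation M π := by
  have h := map_fst_absolutelyContinuous_stateVisitation (M := M) (π := π) 0
  rw [pairKernel_pow_zero_comp] at h
  rwa [show (M.ζ ⊗ₘ π.kernel).map Prod.fst = M.ζ from Measure.fst_compProd _ _] at h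

variable (hae : π.kernel =ᵐ[stateVisitation M π] π'.kernel)
include hae

/-- A policy that agrees with `π` on the states visited by `π` visits the same states. -/
lemma visitation_congr : visitation M π' = visitation M π := by
  have key : ∀ t : ℕ, ⇑(pairKernel M π' ^ t) ∘ₘ (M.ζ ⊗ₘ π'.kernel) =
      ⇑(pairKernel M π ^ t) ∘ₘ (M.ζ ⊗ₘ π.kernel) := by
    intro t
    induction t with
    | zero =>
      rw [pairKernel_pow_zero_comp, pairKernel_pow_zero_comp]
      exact (Measure.compProd_congr (initial_absolutelyContinuous_stateVisitation hae)).symm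
    | succ t ih =>
      have h := map_fst_absolutelyContinuous_stateVisitation (M := M) (π := π) (t + 1)
      rw [pairKernel_pow_succ_comp, map_fst_pairKernel_comp] at h
      rw [pairKernel_pow_succ_comp, pairKernel_pow_succ_comp, pairKernel_comp, pairKernel_comp, ih]
      exact (Measure.compProd_congr (h hae)).symm
  rw [visitation_eq, visitation_eq, resolvent_comp, resolvent_comp]
  simp only [key]

variable {q : ℝ} (hR : ∀ x, ∀ᵐ y ∂(M.R x), |y| ≤ q)
include hR

lemma J_congr : J M π' = J M π := by
  have h1' : 0 < 1 - M.γ := by linarith [M.γ_lt_one]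
  have h1 := performance_difference M π hR π'
  have h2 := performance_difference M π hR π
  rw [visitation_congr hae, ← h2, sub_self, mul_zero, mul_eq_zero] at h1
  exact sub_eq_zero.1 (h1.resolve_left h1'.ne')

/-- The Bellman equation contracts the difference of the values on the visited states. -/
lemma advantage_congr : advantage M π' =ᵐ[visitation M π] advantage M π := by
  have h0 := M.γ_pos
  -- one more transition does not leave the visited states
  have hflow : M.P ∘ₘ visitation M π ≪ stateVisitation M π := by
    refine Measure.AbsolutelyContinuous.mk fun B hB h => ?_
    rw [stateVisitation_flow, Measure.add_apply, add_eq_zero] at h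
    have h2 := h.2
    rw [Measure.smul_apply, smul_eq_mul, mul_eq_zero] at h2
    refine h2.resolve_left ?_
    rw [ENNReal.ofReal_eq_zero, not_le]
    exact h0
  have hV := measurable_V π hR
  have hV' := measurable_V π' hR
  have stepQ : ∀ b : ℝ, (∀ᵐ s ∂(stateVisitation M π), |V M π' s - V M π s| ≤ b) →
      ∀ᵐ x ∂(visitation M π), |Q M π' x - Q M π x| ≤ M.γ * b := by
    intro b hb
    filter_upwards [Measure.ae_ae_of_ae_comp (hflow hb)] with x hx
    rw [Q_bellman π' hR, Q_bellman π hR, add_sub_add_left_eq_sub, ← mul_sub, abs_mul,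
      abs_of_pos h0, ← integral_sub (integrable_of_abs_le hV' (abs_V_le π' hR) _)
      (integrable_of_abs_le hV (abs_V_le π hR) _)]
    exact mul_le_mul_of_nonneg_left (abs_integral_le_of_abs_le _ hx) h0.le
  have iter : ∀ n : ℕ, ∀ᵐ s ∂(stateVisitation M π),
      |V M π' s - V M π s| ≤ M.γ ^ n * (2 * q) := by
    intro n
    induction n with
    | zero =>
      refine ae_of_all _ fun s => ?_
      have e1 := abs_V_le π' hR s
      have e2 := abs_V_le π hR s
      refine (abs_sub _ _).trans ?_
      rw [pow_zero]
      linarith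
    | succ n ih =>
      have h1 := Measure.ae_ae_of_ae_compProd (stepQ _ ih)
      filter_upwards [h1, hae] with s hs hsπ
      have hi : ∀ ρ : Policy S A, Integrable (fun a => Q M ρ (s, a)) (π.kernel s) := fun ρ =>
        integrable_of_abs_le ((measurable_Q ρ hR).comp measurable_prodMk_left)
          (fun a => abs_Q_le ρ hR _) _
      rw [V_eq_integral_Q π' hR, V_eq_integral_Q π hR, ← hsπ, ← integral_sub (hi π') (hi π)]
      refine abs_integral_le_of_abs_le _ ?_
      filter_upwards [hs] with a ha
      exact ha.trans (le_of_eq (by ring))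
  have hVeq : ∀ᵐ s ∂(stateVisitation M π), |V M π' s - V M π s| ≤ 0 := by
    filter_upwards [ae_all_iff.2 iter] with s hs
    have hlim := (tendsto_pow_atTop_nhds_zero_of_lt_one h0.le M.γ_lt_one).mul_const (2 * q)
    rw [zero_mul] at hlim
    exact ge_of_tendsto' hlim hs
  have hVeq' : ∀ᵐ x ∂(visitation M π), |V M π' x.1 - V M π x.1| ≤ 0 := by
    have h := hVeq
    rw [stateVisitation_eq] at h
    exact ae_of_ae_map measurable_fst.aemeasurable h
  filter_upwards [hVeq', stepQ 0 hVeq] with x h1 h2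
  rw [mul_zero, abs_nonpos_iff, sub_eq_zero] at h2
  rw [abs_nonpos_iff, sub_eq_zero] at h1
  rw [advantage, advantage, h1, h2]

end AlmostEverywhere

/-! ### The gradient of the meta-objective -/

section Gradient

variable {E : Type*} [NormedAddCommGroup E] [InnerProductSpace ℝ E] [CompleteSpace E]

lemma inner_integral_smul {X : Type*} [MeasurableSpace X] {μ : Measure X} {w : X → ℝ}
    {f : X → E} (h : Integrable (fun x => w x • f x) μ) (v : E) :
    inner ℝ (∫ x, w x • f x ∂μ) v = ∫ x, w x * inner ℝ (f x) v ∂μ := by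
  rw [real_inner_comm, ← integral_inner h v]
  simp only [inner_smul_right, real_inner_comm]

/-- A quadratic remainder near the base point gives the gradient. -/
lemma hasGradientAt_of_quadratic_remainder {F : E → ℝ} {θ G : E} {C r : ℝ} (hr : 0 < r)
    (h : ∀ v, ‖v‖ ≤ r → |F (θ + v) - F θ - inner ℝ G v| ≤ C * ‖v‖ ^ 2) : HasGradientAt F G θ := by
  rw [hasGradientAt_iff_hasFDerivAt, hasFDerivAt_iff_isLittleO_nhds_zero]
  have hO : (fun v => F (θ + v) - F θ - InnerProductSpace.toDual ℝ E G v) =O[nhds 0]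
      fun v => ‖v‖ ^ 2 := by
    refine Asymptotics.IsBigO.of_bound C ?_
    filter_upwards [Metric.closedBall_mem_nhds (0 : E) hr] with v hv
    rw [mem_closedBall_zero_iff] at hv
    simpa using h v hv
  exact hO.trans_isLittleO (Asymptotics.isLittleO_norm_pow_id one_lt_two)

variable {S A : Type*} [MeasurableSpace S] [Fintype A] [Nonempty A] [MeasurableSpace A]
  [MeasurableSingletonClass A] {M : MDP S A} {d : ℕ} {q : ℝ}
  (hR : ∀ x, ∀ᵐ y ∂(M.R x), |y| ≤ q)
  {φ : S × A → EuclideanSpace ℝ (Fin d)} (hφ : Measurable φ) {B : ℝ} (hB : ∀ x, ‖φ x‖ ≤ B)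
  {τ η : ℝ}

omit [Fintype A] [Nonempty A] [MeasurableSingletonClass A] in
/-- The action-value function is, up to the immediate reward, an expected total reward with
initial distribution `P(· | s, a)`. -/
lemma Q_eq_J_withInit (hR : ∀ x, ∀ᵐ y ∂(M.R x), |y| ≤ q) (π : Policy S A) (x : S × A) :
    Q M π x = (1 - M.γ) * meanReward M x + M.γ * J (M.withInit (M.P x)) π :=
  Q_bellman π hR x

include hB in
omit [MeasurableSpace S] [Fintype A] [Nonempty A] [MeasurableSpace A]
  [MeasurableSingletonClass A] in
lemma abs_inner_feature_le (hτ : 0 < τ) (x : S × A) (v : EuclideanSpace ℝ (Fin d)) :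
    |1 / τ * inner ℝ (φ x) v| ≤ B / τ * ‖v‖ := by
  rw [abs_mul, abs_of_pos (by positivity : 0 < 1 / τ)]
  calc 1 / τ * |inner ℝ (φ x) v| ≤ 1 / τ * (B * ‖v‖) := by
        gcongr
        exact (abs_real_inner_le_norm _ _).trans (by gcongr; exact hB x)
    _ = B / τ * ‖v‖ := by ring

include hR hB in
/-- The policy gradient expansion of the action-value function, uniform in the state and the
action because the remainder does not depend on the initial distribution. -/
lemma abs_Q_mainEffect_remainder_le (hτ : 0 < τ) (θ v : EuclideanSpace ℝ (Fin d))
    (hv : B / τ * ‖v‖ ≤ 1) (x : S × A) :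
    |Q M (mainEffect φ hφ τ (θ + v)) x - Q M (mainEffect φ hφ τ θ) x -
        M.γ / (1 - M.γ) * ∫ x', advantage M (mainEffect φ hφ τ θ) x' *
          (1 / τ * inner ℝ (φ x') v) ∂(visitationFrom M (mainEffect φ hφ τ θ) x)| ≤
      M.γ * (expansionConst q M.γ * (B / τ * ‖v‖) ^ 2) := by
  have hdiff : ∀ x, 1 / τ * inner ℝ (φ x) (θ + v) - 1 / τ * inner ℝ (φ x) θ =
      1 / τ * inner ℝ (φ x) v := fun x => by rw [inner_add_right]; ring
  have h := abs_policy_gradient_remainder_le (M := M.withInit (M.P x)) (q := q) hR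
    (f := fun x => 1 / τ * inner ℝ (φ x) θ) (g := fun x => 1 / τ * inner ℝ (φ x) (θ + v))
    ((hφ.inner measurable_const).const_mul _) ((hφ.inner measurable_const).const_mul _) hv
    (fun x => by rw [hdiff]; exact abs_inner_feature_le hB hτ x v)
  simp only [hdiff] at h
  rw [Q_eq_J_withInit hR, Q_eq_J_withInit hR, visitationFrom_eq_visitation,
    add_sub_add_left_eq_sub, ← mul_sub, div_eq_mul_one_div, mul_assoc, ← mul_sub, abs_mul,
    abs_of_pos M.γ_pos]
  exact mul_le_mul_of_nonneg_left h M.γ_pos.le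

omit [Fintype A] [Nonempty A] [MeasurableSingletonClass A] in
lemma isProbabilityMeasure_visitationFrom (π : Policy S A) (x : S × A) :
    IsProbabilityMeasure (visitationFrom M π x) := by
  rw [visitationFrom_eq]; infer_instance

omit [Fintype A] [Nonempty A] [MeasurableSingletonClass A] in
include hR hφ in
lemma measurable_auxiliary (π : Policy S A) : Measurable (auxiliary M φ τ η π) := by
  have h : ∀ x, visitationFrom M π x = (occupation M π ∘ₖ pairKernel M π) x := fun x => by
    rw [visitationFrom_eq, Kernel.comp_apply, pairKernel_apply]
  have hI : Measurable fun x => ∫ x', advantage M π x' • φ x' ∂(visitationFrom M π x) := by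
    simp only [h]
    exact (StronglyMeasurable.integral_kernel
      ((measurable_advantage π hR).smul hφ).stronglyMeasurable).measurable
  exact (hφ.const_smul (1 / τ)).add (hI.const_smul (η * M.γ / (τ * (1 - M.γ))))

omit [Fintype A] [Nonempty A] [MeasurableSingletonClass A] in
include hR hB in
lemma norm_advantage_smul_feature_le (π : Policy S A) (x : S × A) :
    ‖advantage M π x • φ x‖ ≤ 2 * q * B := by
  rw [norm_smul, Real.norm_eq_abs]
  exact mul_le_mul (abs_advantage_le π hR x) (hB x) (norm_nonneg _)
    ((abs_nonneg _).trans (abs_advantage_le π hR x))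

omit [Fintype A] [Nonempty A] [MeasurableSingletonClass A] in
include hR hB in
lemma norm_auxiliary_le (hτ : 0 < τ) (hη : 0 < η) (π : Policy S A) (x : S × A) :
    ‖auxiliary M φ τ η π x‖ ≤ 1 / τ * B + η * M.γ / (τ * (1 - M.γ)) * (2 * q * B) := by
  have h1' : 0 < 1 - M.γ := by linarith [M.γ_lt_one]
  have h0 := M.γ_pos
  have := isProbabilityMeasure_visitationFrom (M := M) π x
  have h := norm_integral_le_of_norm_le_const (μ := visitationFrom M π x)
    (ae_of_all _ (norm_advantage_smul_feature_le hR hB π))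
  rw [probReal_univ, mul_one] at h
  refine (norm_add_le _ _).trans (add_le_add ?_ ?_)
  · rw [norm_smul, Real.norm_of_nonneg (by positivity)]
    exact mul_le_mul_of_nonneg_left (hB x) (by positivity)
  · rw [norm_smul, Real.norm_of_nonneg (by positivity)]
    exact mul_le_mul_of_nonneg_left h (by positivity)

omit [Fintype A] [Nonempty A] [MeasurableSingletonClass A] in
include hR hB hφ in
lemma inner_auxiliary (π : Policy S A) (x : S × A) (v : EuclideanSpace ℝ (Fin d)) :
    inner ℝ (auxiliary M φ τ η π x) v = 1 / τ * inner ℝ (φ x) v +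
      η * (M.γ / (1 - M.γ) * ∫ x', advantage M π x' * (1 / τ * inner ℝ (φ x') v)
        ∂(visitationFrom M π x)) := by
  have := isProbabilityMeasure_visitationFrom (M := M) π x
  have hi : Integrable (fun x' => advantage M π x' • φ x') (visitationFrom M π x) :=
    Integrable.of_bound ((measurable_advantage π hR).smul hφ).aestronglyMeasurable _
      (ae_of_all _ (norm_advantage_smul_feature_le hR hB π))
  rw [auxiliary, inner_add_left, real_inner_smul_left, real_inner_smul_left,
    inner_integral_smul hi]
  simp only [mul_left_comm _ (1 / τ)]
  rw [integral_const_mul]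
  generalize 1 - M.γ = g
  ring

include hR hB in
/-- The gradient of the expected total reward of the policy produced by one exact proximal step
from the main effect. -/
lemma hasGradientAt_J_adapted (hτ : 0 < τ) (hη : 0 < η)
    (hm : ∀ θ, Measurable
      (fun x => 1 / τ * inner ℝ (φ x) θ + η * Q M (mainEffect φ hφ τ θ) x))
    (θ : EuclideanSpace ℝ (Fin d)) :
    HasGradientAt (fun θ => J M (energyPolicy _ (hm θ)))
      ((1 / (1 - M.γ)) • ∫ x, advantage M (energyPolicy _ (hm θ)) x •
        auxiliary M φ τ η (mainEffect φ hφ τ θ) x ∂(visitation M (energyPolicy _ (hm θ)))) θ := by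
  obtain ⟨s₀⟩ := nonempty_of_isProbabilityMeasure M.ζ
  obtain ⟨a₀⟩ := id ‹Nonempty A›
  have hB0 : 0 ≤ B := (norm_nonneg _).trans (hB (s₀, a₀))
  have hq0 : 0 ≤ q := (abs_nonneg _).trans (abs_meanReward_le hR (s₀, a₀))
  have h1' : 0 < 1 - M.γ := by linarith [M.γ_lt_one]
  have h0 := M.γ_pos
  have hC0 : 0 ≤ expansionConst q M.γ := by unfold expansionConst; positivity
  set C := expansionConst q M.γ with hC
  set H := 1 / τ * B + η * M.γ / (τ * (1 - M.γ)) * (2 * q * B) with hH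
  have hH0 : 0 ≤ H := by positivity
  set K := η * (M.γ * (C * (B / τ) ^ 2)) with hK
  have hK0 : 0 ≤ K := by positivity
  set h := auxiliary M φ τ η (mainEffect φ hφ τ θ) with hh
  have hhm : Measurable h := measurable_auxiliary hR hφ _
  have hhb : ∀ x, ‖h x‖ ≤ H := norm_auxiliary_le hR hB hτ hη _
  have hA := measurable_advantage (energyPolicy _ (hm θ)) hR
  have hAb := abs_advantage_le (energyPolicy _ (hm θ)) hR
  have hAhb : ∀ x, ‖advantage M (energyPolicy _ (hm θ)) x • h x‖ ≤ 2 * q * H := fun x => by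
    rw [norm_smul, Real.norm_eq_abs]
    exact mul_le_mul (hAb x) (hhb x) (norm_nonneg _) (by positivity)
  have hAhi : Integrable (fun x => advantage M (energyPolicy _ (hm θ)) x • h x)
      (visitation M (energyPolicy _ (hm θ))) :=
    Integrable.of_bound (hA.smul hhm).aestronglyMeasurable _ (ae_of_all _ hAhb)
  -- the radius makes every perturbation below at most `1`
  refine hasGradientAt_of_quadratic_remainder
    (C := C * (H + K) ^ 2 + 1 / (1 - M.γ) * (2 * q * K))
    (r := 1 / (1 + B / τ + H + K)) (by positivity) fun v hv => ?_
  rw [le_div_iff₀ (by positivity)] at hv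
  have hv0 := norm_nonneg v
  have hBτ : 0 ≤ B / τ := by positivity
  have hv1 : ‖v‖ ≤ 1 := by nlinarith
  have hv2 : B / τ * ‖v‖ ≤ 1 := by nlinarith
  have hv3 : (H + K) * ‖v‖ ≤ 1 := by nlinarith
  set u : S × A → ℝ := fun x =>
    (1 / τ * inner ℝ (φ x) (θ + v) + η * Q M (mainEffect φ hφ τ (θ + v)) x) -
      (1 / τ * inner ℝ (φ x) θ + η * Q M (mainEffect φ hφ τ θ) x) with hu
  -- the energy is differentiable uniformly in the state and the action
  have hu1 : ∀ x, |u x - inner ℝ (h x) v| ≤ K * ‖v‖ ^ 2 := by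
    intro x
    have e := abs_Q_mainEffect_remainder_le hR hφ hB hτ θ v hv2 x
    have e2 : u x - inner ℝ (h x) v = η * (Q M (mainEffect φ hφ τ (θ + v)) x -
        Q M (mainEffect φ hφ τ θ) x - M.γ / (1 - M.γ) *
          ∫ x', advantage M (mainEffect φ hφ τ θ) x' *
          (1 / τ * inner ℝ (φ x') v) ∂(visitationFrom M (mainEffect φ hφ τ θ) x)) := by
      rw [hh, inner_auxiliary hR hφ hB, hu]
      simp only [inner_add_right]
      ring
    rw [e2, abs_mul, abs_of_pos hη]
    refine (mul_le_mul_of_nonneg_left e hη.le).trans (le_of_eq ?_)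
    rw [hK]; ring
  have hu2 : ∀ x, |u x| ≤ (H + K) * ‖v‖ := by
    intro x
    have e1 : |inner ℝ (h x) v| ≤ H * ‖v‖ :=
      (abs_real_inner_le_norm _ _).trans (mul_le_mul_of_nonneg_right (hhb x) hv0)
    have e2 : K * ‖v‖ ^ 2 ≤ K * ‖v‖ := mul_le_mul_of_nonneg_left (by nlinarith) hK0
    have e3 := abs_add_le (u x - inner ℝ (h x) v) (inner ℝ (h x) v)
    rw [sub_add_cancel] at e3
    linarith [hu1 x]
  have hum : Measurable u := (hm (θ + v)).sub (hm θ)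
  have hmain := abs_policy_gradient_remainder_le hR (hm θ) (hm (θ + v)) hv3 hu2
  have hAu : ∀ x, |advantage M (energyPolicy _ (hm θ)) x * u x| ≤ 2 * q * ((H + K) * ‖v‖) :=
    fun x => by
      rw [abs_mul]; exact mul_le_mul (hAb x) (hu2 x) (abs_nonneg _) (by positivity)
  have hAl : ∀ x, |advantage M (energyPolicy _ (hm θ)) x * inner ℝ (h x) v| ≤
      2 * q * (H * ‖v‖) := fun x => by
    rw [abs_mul]
    exact mul_le_mul (hAb x) ((abs_real_inner_le_norm _ _).trans
      (mul_le_mul_of_nonneg_right (hhb x) hv0)) (abs_nonneg _) (by positivity)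
  have hlin : |∫ x, advantage M (energyPolicy _ (hm θ)) x * u x
        ∂(visitation M (energyPolicy _ (hm θ))) -
      ∫ x, advantage M (energyPolicy _ (hm θ)) x * inner ℝ (h x) v
        ∂(visitation M (energyPolicy _ (hm θ)))| ≤ 2 * q * (K * ‖v‖ ^ 2) := by
    have hi1 := integrable_of_abs_le
      (f := fun x => advantage M (energyPolicy _ (hm θ)) x * u x) (hA.mul hum) hAu
      (visitation M (energyPolicy _ (hm θ)))
    have hi2 := integrable_of_abs_le
      (f := fun x => advantage M (energyPolicy _ (hm θ)) x * inner ℝ (h x) v)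
      (hA.mul (hhm.inner measurable_const)) hAl (visitation M (energyPolicy _ (hm θ)))
    rw [← integral_sub hi1 hi2]
    refine abs_integral_le_of_abs_le _ (ae_of_all _ fun x => ?_)
    rw [← mul_sub, abs_mul]
    exact mul_le_mul (hAb x) (hu1 x) (abs_nonneg _) (by positivity)
  rw [real_inner_smul_left, inner_integral_smul hAhi]
  have hlin' := mul_le_mul_of_nonneg_left hlin (by positivity : 0 ≤ 1 / (1 - M.γ))
  rw [← abs_of_pos (by positivity : 0 < 1 / (1 - M.γ)), ← abs_mul,
    abs_of_pos (by positivity : 0 < 1 / (1 - M.γ)), mul_sub] at hlin'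
  -- replace the increment of the energy by its linear part
  have hfin := (abs_add_le _ _).trans (add_le_add hmain hlin')
  rw [sub_add_sub_cancel] at hfin
  refine hfin.trans (le_of_eq ?_)
  ring

end Gradient

end MetaRL

theorem mainTheorem6 {S A : Type*} [MeasurableSpace S] [Fintype A] [Nonempty A]
    [MeasurableSpace A] [MeasurableSingletonClass A] {n d : ℕ} (M : Fin n → MDP S A)
    (Qmax : ℝ) (hR : ∀ (i : Fin n) (x : S × A), ∀ᵐ y ∂((M i).R x), |y| ≤ Qmax)
    (φ : S × A → EuclideanSpace ℝ (Fin d)) (hφ : Measurable φ)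
    (B : ℝ) (hB : ∀ x, ‖φ x‖ ≤ B)
    (τ η : ℝ) (hτ : 0 < τ) (hη : 0 < η) :
    (∀ (i : Fin n) (θ : EuclideanSpace ℝ (Fin d)),
      ∃ hf : Measurable
          (fun x => 1 / τ * inner ℝ (φ x) θ + η * Q (M i) (mainEffect φ hφ τ θ) x),
        IsPPOStep (M i) η (mainEffect φ hφ τ θ) (energyPolicy _ hf)) ∧
    ∀ πad : Fin n → EuclideanSpace ℝ (Fin d) → Policy S A,
      (∀ i θ, IsPPOStep (M i) η (mainEffect φ hφ τ θ) (πad i θ)) →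
      ∀ θ : EuclideanSpace ℝ (Fin d),
        HasGradientAt (metaObjective M πad)
          ((1 / (n : ℝ)) • ∑ i, (1 / (1 - (M i).γ)) •
            ∫ x, advantage (M i) (πad i θ) x •
              auxiliary (M i) φ τ η (mainEffect φ hφ τ θ) x
              ∂(visitation (M i) (πad i θ))) θ := by
  have hlin : ∀ θ : EuclideanSpace ℝ (Fin d), Measurable fun x => 1 / τ * inner ℝ (φ x) θ :=
    fun θ => (hφ.inner measurable_const).const_mul _
  have hm : ∀ (i : Fin n) (θ : EuclideanSpace ℝ (Fin d)), Measurable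
      (fun x => 1 / τ * inner ℝ (φ x) θ + η * Q (M i) (mainEffect φ hφ τ θ) x) := fun i θ =>
    (hlin θ).add ((measurable_Q _ (hR i)).const_mul _)
  have hb := fun (θ : EuclideanSpace ℝ (Fin d)) x => abs_inner_feature_le hB hτ x θ
  refine ⟨fun i θ => ⟨hm i θ, isPPOStep_energyPolicy (hR i) hη (hlin θ) (hb θ) (hm i θ)⟩, ?_⟩
  intro πad hπ θ
  -- a maximizer agrees with the energy-based one on all states visited by `π_θ`, hence on those
  -- visited by the energy-based maximizer, as `π_θ` charges every action
  have hae : ∀ i θ, (energyPolicy _ (hm i θ)).kernel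
      =ᵐ[stateVisitation (M i) (energyPolicy _ (hm i θ))] (πad i θ).kernel := fun i θ =>
    stateVisitation_absolutelyContinuous
      (fun s => absolutelyContinuous_of_singleton_pos (energyPolicy_singleton_pos _ (hlin θ) s))
      (IsPPOStep.ae_eq (hR i) hη (hlin θ) (hb θ) (hπ i θ) (hm i θ))
  have hobj : metaObjective M πad =
      fun θ => 1 / (n : ℝ) * ∑ i, J (M i) (energyPolicy _ (hm i θ)) := by
    funext θ
    simp only [metaObjective, J_congr (hae _ θ) (hR _)]
  have hgrad : ∀ i, ∫ x, advantage (M i) (πad i θ) x •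
        auxiliary (M i) φ τ η (mainEffect φ hφ τ θ) x ∂(visitation (M i) (πad i θ)) =
      ∫ x, advantage (M i) (energyPolicy _ (hm i θ)) x •
        auxiliary (M i) φ τ η (mainEffect φ hφ τ θ) x
        ∂(visitation (M i) (energyPolicy _ (hm i θ))) := by
    intro i
    rw [visitation_congr (hae i θ)]
    refine integral_congr_ae ?_
    filter_upwards [advantage_congr (hae i θ) (hR i)] with x hx
    rw [hx]
  simp only [hobj, hgrad]
  rw [hasGradientAt_iff_hasFDerivAt]
  have hsum := (HasFDerivAt.fun_sum fun i (_ : i ∈ Finset.univ) =>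
    (hasGradientAt_iff_hasFDerivAt.1
      (hasGradientAt_J_adapted (hR i) hφ hB hτ hη (hm i) θ))).const_mul (1 / (n : ℝ))
  refine hsum.congr_fderiv ?_
  rw [map_smul, map_sum]
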